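/- Let $p>2^{6}$ be a prime and $\mathbb F_p$ the field of $p$ elements. **Definitions.** A left brace is a set $A$ with operations $+,\circ$ such that $(A,+)$ is an abelian group, $(A,\circ)$ is a group and $a\circ(b+c)+a=a\circ b+a\circ c$; put $a*b=a\circ b-a-b$. It is an $\mathbb F_p$-brace if $(A,+)$ is an $\mathbb F_p$-vector space and $a*(\alpha b)=\alpha(a*b)$ for $\alpha\in\mathbb F_p$. It is right nilpotent if $A^{(n)}=0$ for some $n$, where $A^{(1)}=A$ and $A^{(i+1)}$ consists of the sums of elements $a*b$ with $a\in A^{(i)}$, $b\in A$. It is generated by $x$ if no proper subbrace contains $x$. A pre-Lie algebra over $\mathbb F_p$ is a vector space with a bilinear product satisfying $(ab)c-a(bc)=(ba)c-b(ac)$; $A^{i}$ denotes the span of all products of $i$ or more elements, and $x^2=x\cdot x$. If $A^{k}=0$ for some $k\le p$, put $e^{L_a}(b)=\sum_{i\ge0}\frac1{i!}L_a^i(b)$ with $L_a(b)=a\cdot b$, and $W(a)=\sum_{i\ge 0}\frac1{(i+1)!}L_a^{i}(a)$. (Here the sums are finite: all terms with $i\ge k-1$ vanish.) The map $W$ is bijective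 with inverse $\Omega$, and the group of flows of $A$ is the set $A$ with the multiplication $a\circ b=a+e^{L_{\Omega(a)}}(b)$; it is considered together with the addition of $A$. **The list.** Let $\mathcal L$ be the class of pairs $(A,x)$ where $A$ is a pre-Lie algebra over $\mathbb F_p$ of cardinality $p^4$, generated as a pre-Lie algebra by $x\in A$, and one of the following holds. 1. $A^5\ne0$, $A^6=0$; the elements $x,\ x^2,\ x^2x,\ x^2(x^2x)$ form a base of $A$; every product of $5$ or more copies of $x$, with any distribution of brackets, is zero except for $x^2(x^2x)$; moreover $x(xx^2)=0$, $(xx^2)x=0$, $x^2x^2=x(x^2x)+(x^2x)x$, and for some $\alpha,\beta,\gamma\in\mathbb F_p$ $$xx^2=\alpha\,x^2(x^2x),\qquad (x^2x)x=\beta\,x^2(x^2x),\qquad x(x^2x)=\gamma\,x^2(x^2x).$$ 2. $A^4\ne0$, $A^5=0$; for some $a\in\{xx^2,\,x^2x\}$ and $b\in\{xa,\,ax\}$ the elements $x,x^2,a,b$ form a base of $A$, each $A^i$ is spanned by those of these four elements that lie in $A^i$, and $A^4=\mathbb F_p b$; moreover $(x^2x)x-(xx^2)x=x^2x^2-x(x^2x)$,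 and for some $\alpha,\beta,\delta,\mu\in\mathbb F_p$ with $\alpha,\beta$ not both zero, the other one of $xa$, $ax$ equals $\mu b$, and $$\alpha\,xx^2+\beta\,x^2x=\delta b,\qquad \alpha\,x(xx^2)+\beta\,x(x^2x)=0,\qquad \alpha\,(xx^2)x+\beta\,(x^2x)x=0.$$ 3. $A^4=0$ and the elements $x,\ x^2,\ x^2x,\ xx^2$ form a base of $A$. **Statement.** (a) Let $(A,+,\circ)$ be a right nilpotent $\mathbb F_p$-brace of cardinality $p^4$ generated as a brace by one element $x$. Then, up to an $\mathbb F_p$-linear identification, $(A,\circ)$ is the group of flows of a pre-Lie algebra with the same additive group which, together with $x$, belongs to $\mathcal L$. (b) Conversely, for every $(A,x)\in\mathcal L$ the group of flows of $A$, with the addition of $A$, is a right nilpotent $\mathbb F_p$-brace of cardinality $p^4$ generated as a brace by $x$. (c) The lists of relations are consistent: a pair as in 1 exists for all $\alpha,\beta,\gamma\in\mathbb F_p$; a pair as in 2 with $a=xx^2$ exists for all $\alpha,\beta,\delta,\mu\in\mathbb F_p$ with $\beta\neq0$, and one with $a=x^2x$ for all $\alpha,\beta,\delta,\mu\in\mathbb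 F_p$ with $\alpha\ne0$, in each case both with $b=xa$ and with $b=ax$; and a pair as in 3 exists. -/

import Mathlib

universe u

/-! ### Left braces and `F`-braces -/

section Braces

variable {A : Type u} [AddCommGroup A]

/-- `(A, +, ∘)` is a left brace: `(A, +)` is an abelian group, `(A, ∘)` is a group and
`a ∘ (b + c) + a = a ∘ b + a ∘ c`. -/
structure IsLeftBrace (circ : A → A → A) : Prop where
  circ_assoc : ∀ a b c, circ (circ a b) c = circ a (circ b c)
  exists_neutral : ∃ e, (∀ a, circ e a = a ∧ circ a e = a) ∧
    ∀ a, ∃ b, circ b a = e ∧ circ a b = e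
  circ_add : ∀ a b c, circ a (b + c) + a = circ a b + circ a c

/-- The operation `a * b = a ∘ b - a - b` of a brace. -/
def braceStar (circ : A → A → A) (a b : A) : A := circ a b - a - b

/-- An `F`-brace: a left brace on an `F`-vector space with `a * (α b) = α (a * b)`. -/
structure IsFBrace (F : Type*) [Field F] [Module F A] (circ : A → A → A) : Prop
    extends IsLeftBrace circ where
  star_smul : ∀ (r : F) (a b : A), braceStar circ a (r • b) = r • braceStar circ a b

/-- In a left brace the neutral element of `(A, ∘)` is `0`. -/
theorem IsLeftBrace.neutral_zero {circ : A → A → A} (h : IsLeftBrace circ) (a : A) :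
    circ 0 a = a ∧ circ a 0 = a := by
  obtain ⟨e, he, -⟩ := h.exists_neutral
  have h0 : ∀ a, circ a 0 = a := fun a => by
    have := h.circ_add a 0 0
    rw [add_zero] at this
    exact (add_left_cancel this).symm
  have : e = 0 := by rw [← h0 e]; exact (he 0).1
  exact ⟨this ▸ (he a).1, h0 a⟩

/-- `braceRightSeries circ n` is the term `A^(n+1)` of the radical chain
`A^(1) = A`, `A^(i+1) = A^(i) * A` (sums of elements `a * b` with `a ∈ A^(i)`, `b ∈ A`). -/
def braceRightSeries (circ : A → A → A) : ℕ → AddSubgroup A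
  | 0 => ⊤
  | n + 1 => AddSubgroup.closure
      {c | ∃ a ∈ braceRightSeries circ n, ∃ b : A, c = braceStar circ a b}

/-- A brace is right nilpotent if `A^(n) = 0` for some `n ≥ 1`. -/
def IsRightNilpotentBrace (circ : A → A → A) : Prop :=
  ∃ n, braceRightSeries circ n = ⊥

/-- The brace is generated by `x`: the only subbrace (additive subgroup which is also a subgroup
of `(A, ∘)`, whose neutral element is `0`) containing `x` is the whole brace. -/
def BraceGeneratedBy (circ : A → A → A) (x : A) : Prop :=
  ∀ S : AddSubgroup A, x ∈ S → (∀ a ∈ S, ∀ b ∈ S, circ a b ∈ S) →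
    (∀ a ∈ S, ∀ b, circ a b = 0 → b ∈ S) → S = ⊤

end Braces

/-! ### Powers of pre-Lie algebras and the group of flows -/

section PreLie

/-- `IsProductOf n a`: `a` is a product of `n` elements, with some distribution of brackets. -/
inductive IsProductOf {P : Type u} [Mul P] : ℕ → P → Prop
  | single (a : P) : IsProductOf 1 a
  | mul {m n : ℕ} {a b : P} : IsProductOf m a → IsProductOf n b → IsProductOf (m + n) (a * b)

variable (p : ℕ) {P : Type u} [LeftPreLieRing P] [LeftPreLieAlgebra (ZMod p) P]

variable (P) in
/-- `A^n`: the linear span of all products of `n` or more elements. -/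
def preLiePower (n : ℕ) : Submodule (ZMod p) P :=
  Submodule.span (ZMod p) {a | ∃ m, n ≤ m ∧ IsProductOf m a}

/-- `e^{L_a}(b) = b + a b + (1/2!) a (a b) + (1/3!) a (a (a b)) + ⋯`. When all products of `p`
elements vanish (the only case in which this is used), the terms from the `p`-th on are zero;
before that the denominators are invertible. -/
noncomputable def flowExp (a b : P) : P :=
  ∑ i ∈ Finset.range p, ((i.factorial : ZMod p)⁻¹) • ((fun y => a * y)^[i] b)

/-- `W(a) = e^{L_a}(1) - 1 = a + (1/2!) a a + (1/3!) a (a a) + ⋯`. -/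
noncomputable def flowW (a : P) : P :=
  ∑ i ∈ Finset.range (p - 1), (((i + 1).factorial : ZMod p)⁻¹) • ((fun y => a * y)^[i] a)

/-- `Ω`, the inverse function of `W` (which is bijective if the pre-Lie algebra is nilpotent). -/
noncomputable def flowOmega : P → P := Function.invFun (flowW p : P → P)

/-- The multiplication `a ∘ b = a + e^{L_{Ω(a)}}(b)` of the group of flows. -/
noncomputable def flowCirc (a b : P) : P := a + flowExp p (flowOmega p a) b

end PreLie

/-! ### The list of one-generator pre-Lie algebras of cardinality `p ^ 4` -/

section List

variable (p : ℕ) {P : Type u} [LeftPreLieRing P] [LeftPreLieAlgebra (ZMod p) P]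

/-- The elements `v 0, v 1, v 2, v 3` form a base of the vector space. -/
def IsBase (v : Fin 4 → P) : Prop :=
  LinearIndependent (ZMod p) v ∧ Submodule.span (ZMod p) (Set.range v) = ⊤

/-- `P` has cardinality `p ^ 4` and is generated as a pre-Lie algebra by `x`. -/
def IsOneGenerated (x : P) : Prop :=
  Nat.card P = p ^ 4 ∧ NonUnitalAlgebra.adjoin (ZMod p) {x} = ⊤

/-- First family: `A^5 ≠ 0`, `A^6 = 0`, with parameters `α, β, γ`. -/
structure IsFirstType (x : P) (α β γ : ZMod p) : Prop where
  gen : IsOneGenerated p x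
  pow_five : preLiePower p P 5 ≠ ⊥
  pow_six : preLiePower p P 6 = ⊥
  base : IsBase p ![x, x * x, (x * x) * x, (x * x) * ((x * x) * x)]
  /-- All products of `5` or more elements `x`, with any distribution of brackets, are zero,
  except for `x² (x² x)`. -/
  long_products : ∀ w : FreeMagma Unit, 5 ≤ w.length →
    w ≠ (FreeMagma.of () * FreeMagma.of ()) *
      ((FreeMagma.of () * FreeMagma.of ()) * FreeMagma.of ()) →
    FreeMagma.lift (fun _ => x) w = 0
  rel₁ : x * (x * (x * x)) = 0
  rel₂ : (x * (x * x)) * x = 0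
  rel₃ : (x * x) * (x * x) = x * ((x * x) * x) + ((x * x) * x) * x
  rel_α : x * (x * x) = α • ((x * x) * ((x * x) * x))
  rel_β : ((x * x) * x) * x = β • ((x * x) * ((x * x) * x))
  rel_γ : x * ((x * x) * x) = γ • ((x * x) * ((x * x) * x))

/-- Second family: `A^4 ≠ 0`, `A^5 = 0`, with base `x, x², a, b` and parameters
`α, β, δ, μ`. -/
structure IsSecondType (x a b : P) (α β δ μ : ZMod p) : Prop where
  gen : IsOneGenerated p x
  pow_four : preLiePower p P 4 ≠ ⊥
  pow_five : preLiePower p P 5 = ⊥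
  base : IsBase p ![x, x * x, a, b]
  a_choice : a = x * (x * x) ∨ a = (x * x) * x
  b_choice : (b = x * a ∧ a * x = μ • b) ∨ (b = a * x ∧ x * a = μ • b)
  base_adapted : ∀ i, preLiePower p P i =
    Submodule.span (ZMod p) (({x, x * x, a, b} : Set P) ∩ (preLiePower p P i : Set P))
  pow_four_eq : preLiePower p P 4 = Submodule.span (ZMod p) {b}
  rel : ((x * x) * x) * x - (x * (x * x)) * x = (x * x) * (x * x) - x * ((x * x) * x)
  not_both_zero : ¬(α = 0 ∧ β = 0)
  rel_δ : α • (x * (x * x)) + β • ((x * x) * x) = δ • b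
  rel_left : α • (x * (x * (x * x))) + β • (x * ((x * x) * x)) = 0
  rel_right : α • ((x * (x * x)) * x) + β • (((x * x) * x) * x) = 0

/-- Third type: `A^4 = 0`, with base `x, x², x² x, x x²`. -/
structure IsThirdType (x : P) : Prop where
  gen : IsOneGenerated p x
  pow_four : preLiePower p P 4 = ⊥
  base : IsBase p ![x, x * x, (x * x) * x, x * (x * x)]

/-- The pre-Lie algebra `P` with generator `x` is one of those in the list. -/
def IsListed (x : P) : Prop :=
  (∃ α β γ, IsFirstType p x α β γ) ∨
  (∃ a b : P, ∃ α β δ μ, IsSecondType p x a b α β δ μ) ∨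
  IsThirdType p x

end List

/-! Both directions pass through four-dimensional multiplications that are strictly triangular in a
basis e₀, e₁, e₂, e₃ (`flagMul`), for which the pre-Lie identity amounts to two equations between
structure constants (`FlagConstants.IsPreLie`).

From algebras to braces: every listed algebra has such a table. By the pre-Lie identity, u ↦ L_u is
a representation of the commutator Lie algebra. Commutators have only e₂- and e₃-coordinates, so
this Lie algebra has class at most three and the Baker–Campbell–Hausdorff series stops at degree
three. Hence e^{L_u} e^{L_v} = e^{L_{u·v}} and W(u·v) = W(u) + e^{L_u} W(v), where u·v is the
truncated series (`flowExp_bchThree`, `flowW_bchThree`); these give the brace axioms. The logarithm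
of e^{L_u} and the series t/(e^t - 1) recover the product from the brace, so generation as a brace
and as an algebra agree.

From braces to algebras: put λ_a(b) = a ∘ b - a. Right nilpotency and the fixed point theorem for
p-groups give a chain of ideals with one-dimensional quotients (`exists_ideal_step`). In an adapted
basis with e₀ = x, every λ_a is unitriangular and its k-th row depends only on the coordinates of a
before the k-th (`exists_flagAction`). The composition law of λ makes the entries additive up to
explicit polynomial defects, hence polynomials, since additive functions on the prime field are
linear. Comparing a ∘ b with b ∘ a removes the unwanted constants and yields exactly the two pre-Lie
equations (`FlagAction.exists_constants`). The resulting polynomials are the entries of e^{L_u} at a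
= W(u), so ∘ is the multiplication of flows.

Generation by x forces c ≠ 0 and (s, t) ≠ (0, 0). The three families then correspond to l ≠ 0
(first), l = 0 with g or h nonzero (second), and l = g = h = 0 (third); see `isListed_of_flag`. -/

set_option linter.unusedSimpArgs false
set_option linter.unusedSectionVars false

/-! ### Multiplication tables adapted to a flag -/

/-- Structure constants of a multiplication on a four-dimensional space which is strictly
triangular with respect to a basis `e₀, e₁, e₂, e₃`:
`e₀e₀ = c e₁ + q e₂ + r e₃`, `e₀e₁ = s e₂ + s' e₃`, `e₁e₀ = t e₂ + t' e₃`, `e₀e₂ = g e₃`,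
`e₂e₀ = h e₃`, `e₁e₁ = k e₃`, `e₁e₂ = l e₃`, and all other products are zero. -/
structure FlagConstants (K : Type*) where
  (c q r s s' t t' g h k l : K)

/-- The conditions on the structure constants under which the multiplication is pre-Lie. -/
structure FlagConstants.IsPreLie {K : Type*} [CommRing K] (T : FlagConstants K) : Prop where
  s_mul_l : T.s * T.l = 0
  c_mul_k : T.c * T.k + T.q * T.l = T.t * T.h + T.t * T.g - T.s * T.h

/-- The multiplication with structure constants `T` in the basis `b`. -/
noncomputable def flagMul {K V : Type*} [CommRing K] [AddCommGroup V] [Module K V]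
    (T : FlagConstants K) (b : Module.Basis (Fin 4) K V) (u v : V) : V :=
  (T.c * (b.repr u 0 * b.repr v 0)) • b 1 +
  (T.q * (b.repr u 0 * b.repr v 0) + T.s * (b.repr u 0 * b.repr v 1) +
    T.t * (b.repr u 1 * b.repr v 0)) • b 2 +
  (T.r * (b.repr u 0 * b.repr v 0) + T.s' * (b.repr u 0 * b.repr v 1) +
    T.t' * (b.repr u 1 * b.repr v 0) + T.g * (b.repr u 0 * b.repr v 2) +
    T.h * (b.repr u 2 * b.repr v 0) + T.k * (b.repr u 1 * b.repr v 1) +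
    T.l * (b.repr u 1 * b.repr v 2)) • b 3

section FlagMul

variable {K V : Type*} [CommRing K] [AddCommGroup V] [Module K V]
  (T : FlagConstants K) (b : Module.Basis (Fin 4) K V)

theorem Module.Basis.eq_of_repr_fin_four {u v : V} (h0 : b.repr u 0 = b.repr v 0)
    (h1 : b.repr u 1 = b.repr v 1) (h2 : b.repr u 2 = b.repr v 2)
    (h3 : b.repr u 3 = b.repr v 3) : u = v := by
  refine b.ext_elem fun i => ?_
  fin_cases i <;> assumption

theorem repr_flagMul_zero (u v : V) : b.repr (flagMul T b u v) 0 = 0 := by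
  simp [flagMul]

theorem repr_flagMul_one (u v : V) :
    b.repr (flagMul T b u v) 1 = T.c * (b.repr u 0 * b.repr v 0) := by
  simp [flagMul]

theorem repr_flagMul_two (u v : V) :
    b.repr (flagMul T b u v) 2 = T.q * (b.repr u 0 * b.repr v 0) +
      T.s * (b.repr u 0 * b.repr v 1) + T.t * (b.repr u 1 * b.repr v 0) := by
  simp [flagMul]

theorem repr_flagMul_three (u v : V) :
    b.repr (flagMul T b u v) 3 = T.r * (b.repr u 0 * b.repr v 0) +
      T.s' * (b.repr u 0 * b.repr v 1) + T.t' * (b.repr u 1 * b.repr v 0) +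
      T.g * (b.repr u 0 * b.repr v 2) + T.h * (b.repr u 2 * b.repr v 0) +
      T.k * (b.repr u 1 * b.repr v 1) + T.l * (b.repr u 1 * b.repr v 2) := by
  simp [flagMul]

end FlagMul

/-! ### Flows of pre-Lie algebras in which fourfold left multiplications vanish -/

section FlowFormulas

variable {p : ℕ} [Fact p.Prime] {P : Type u} [LeftPreLieRing P] [LeftPreLieAlgebra (ZMod p) P]

theorem ZMod.natCast_ne_zero_of_pos_of_lt {m : ℕ} (h0 : 0 < m) (hm : m < p) :
    (m : ZMod p) ≠ 0 := by
  rw [Ne, ZMod.natCast_eq_zero_iff]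
  exact fun h => absurd (Nat.le_of_dvd h0 h) (by omega)

theorem iterate_mulLeft_eq_zero (hL : ∀ a b : P, a * (a * (a * (a * b))) = 0) (a b : P) {i : ℕ}
    (hi : 4 ≤ i) : (fun y => a * y)^[i] b = 0 := by
  obtain ⟨j, rfl⟩ := Nat.exists_eq_add_of_le' hi
  induction j generalizing b with
  | zero => simpa using hL a b
  | succ j ih =>
    rw [show j + 1 + 4 = (j + 4) + 1 by ring, Function.iterate_succ_apply]
    exact ih _ (by omega)

theorem flowExp_eq (hp : 64 < p) (hL : ∀ a b : P, a * (a * (a * (a * b))) = 0) (a b : P) :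
    flowExp p a b = b + a * b + (2 : ZMod p)⁻¹ • (a * (a * b)) +
      (6 : ZMod p)⁻¹ • (a * (a * (a * b))) := by
  unfold flowExp
  rw [← Finset.sum_subset (Finset.range_subset_range.2 (show 4 ≤ p by omega))]
  · simp only [Finset.sum_range_succ, Finset.sum_range_zero, Nat.factorial]
    norm_num
  · intro i _ hi
    rw [iterate_mulLeft_eq_zero hL a b (by simpa using hi), smul_zero]

theorem flowW_eq (hp : 64 < p) (hL : ∀ a b : P, a * (a * (a * (a * b))) = 0) (a : P) :
    flowW p a = a + (2 : ZMod p)⁻¹ • (a * a) + (6 : ZMod p)⁻¹ • (a * (a * a)) +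
      (24 : ZMod p)⁻¹ • (a * (a * (a * a))) := by
  unfold flowW
  rw [← Finset.sum_subset (Finset.range_subset_range.2 (show 4 ≤ p - 1 by omega))]
  · simp only [Finset.sum_range_succ, Finset.sum_range_zero, Nat.factorial, zero_add]
    norm_num
  · intro i _ hi
    rw [iterate_mulLeft_eq_zero hL a a (by simpa using hi), smul_zero]

end FlowFormulas

/-! ### Flows of flag algebras -/

section FlagFlow

variable {p : ℕ} [Fact p.Prime] {P : Type u} [LeftPreLieRing P] [LeftPreLieAlgebra (ZMod p) P]
  {T : FlagConstants (ZMod p)} {b : Module.Basis (Fin 4) (ZMod p) P}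

/-- The two equations are the e₃-coordinates of the pre-Lie identity on (e₀, e₁, e₁) and (e₀, e₁,
e₀). -/
theorem flagMul_isPreLie (hT : ∀ u v : P, u * v = flagMul T b u v) : T.IsPreLie := by
  have h1 := congrArg (fun z => b.repr z 3) (LeftPreLieRing.assoc_symm (b 0) (b 1) (b 0))
  have h2 := congrArg (fun z => b.repr z 3) (LeftPreLieRing.assoc_symm (b 0) (b 1) (b 1))
  have h3 := congrArg (fun z => b.repr z 3) (LeftPreLieRing.assoc_symm (b 0) (b 1) (b 2))
  simp [associator, hT, repr_flagMul_zero, repr_flagMul_one, repr_flagMul_two,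
    repr_flagMul_three, -mul_eq_zero, -zero_eq_mul] at h1 h2 h3
  constructor
  · exact (mul_comm _ _).trans h2
  · linear_combination h1

theorem flagMul_left_nilpotent (hT : ∀ u v : P, u * v = flagMul T b u v)
    (u v : P) : u * (u * (u * (u * v))) = 0 := by
  apply b.eq_of_repr_fin_four <;>
  simp [hT, repr_flagMul_zero, repr_flagMul_one, repr_flagMul_two, repr_flagMul_three]

/-- Each coordinate of W(u) is that of u plus a polynomial in the earlier ones, so the coordinates
of u can be recovered one after another. -/
theorem flow_injective (hp : 64 < p) (hT : ∀ u v : P, u * v = flagMul T b u v) :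
    Function.Injective (flowW p : P → P) := by
  have hL := flagMul_left_nilpotent hT
  intro u v h
  rw [flowW_eq hp hL, flowW_eq hp hL] at h
  have h0 := congrArg (fun z => b.repr z 0) h
  have h1 := congrArg (fun z => b.repr z 1) h
  have h2 := congrArg (fun z => b.repr z 2) h
  have h3 := congrArg (fun z => b.repr z 3) h
  simp only [hT, map_add, map_smul, Finsupp.add_apply, Finsupp.smul_apply, smul_eq_mul,
    repr_flagMul_zero, repr_flagMul_one, repr_flagMul_two, repr_flagMul_three, mul_zero,
    add_zero, zero_mul, zero_add] at h0 h1 h2 h3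
  rw [h0] at h1 h2 h3
  have h1 := add_right_cancel h1
  rw [h1] at h2 h3
  simp only [add_left_inj] at h2
  rw [h2] at h3
  simp only [add_left_inj] at h3
  exact b.eq_of_repr_fin_four h0 h1 h2 h3

/-- The Baker–Campbell–Hausdorff series up to degree three. -/
def bchThree (p : ℕ) {P : Type u} [LeftPreLieRing P] [LeftPreLieAlgebra (ZMod p) P]
    (u v : P) : P :=
  u + v + (2 : ZMod p)⁻¹ • (u * v - v * u) +
    (12 : ZMod p)⁻¹ • (u * (u * v - v * u) - (u * v - v * u) * u) +
    (12 : ZMod p)⁻¹ • (v * (v * u - u * v) - (v * u - u * v) * v)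

theorem flow_ne_zero (hp : 64 < p) : (2 : ZMod p) ≠ 0 ∧ (3 : ZMod p) ≠ 0 ∧ (6 : ZMod p) ≠ 0 ∧
    (12 : ZMod p) ≠ 0 ∧ (24 : ZMod p) ≠ 0 := by
  have key : ∀ m : ℕ, 0 < m → m < 64 → (m : ZMod p) ≠ 0 := fun m h h' =>
    ZMod.natCast_ne_zero_of_pos_of_lt h (h'.trans hp)
  refine ⟨?_, ?_, ?_, ?_, ?_⟩
  · exact_mod_cast key 2 (by omega) (by omega)
  · exact_mod_cast key 3 (by omega) (by omega)
  · exact_mod_cast key 6 (by omega) (by omega)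
  · exact_mod_cast key 12 (by omega) (by omega)
  · exact_mod_cast key 24 (by omega) (by omega)

theorem repr_flowExp (hp : 64 < p) (hT : ∀ u v : P, u * v = flagMul T b u v) (u v : P) :
    b.repr (flowExp p u v) 0 = b.repr v 0 ∧
    b.repr (flowExp p u v) 1 = b.repr v 1 + T.c * (b.repr u 0 * b.repr v 0) ∧
    b.repr (flowExp p u v) 2 = b.repr v 2 + T.s * b.repr u 0 * b.repr v 1 +
      (T.q * b.repr u 0 + T.t * b.repr u 1 + T.s * T.c * b.repr u 0 ^ 2 / 2) * b.repr v 0 ∧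
    b.repr (flowExp p u v) 3 = b.repr v 3 + (T.g * b.repr u 0 + T.l * b.repr u 1) * b.repr v 2 +
      (T.s' * b.repr u 0 + T.k * b.repr u 1 +
        (T.g * b.repr u 0 + T.l * b.repr u 1) * (T.s * b.repr u 0) / 2) * b.repr v 1 +
      (T.r * b.repr u 0 + T.t' * b.repr u 1 + T.h * b.repr u 2 +
        ((T.s' * b.repr u 0 + T.k * b.repr u 1) * (T.c * b.repr u 0) +
          (T.g * b.repr u 0 + T.l * b.repr u 1) * (T.q * b.repr u 0 + T.t * b.repr u 1)) / 2 +
        (T.g * b.repr u 0 + T.l * b.repr u 1) * (T.s * b.repr u 0) * (T.c * b.repr u 0) / 6) *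
        b.repr v 0 := by
  obtain ⟨h2, h3, h6, -, -⟩ := flow_ne_zero hp
  have hL := flagMul_left_nilpotent hT
  simp only [flowExp_eq hp hL, hT, map_add, map_smul, Finsupp.add_apply,
    Finsupp.smul_apply, smul_eq_mul, repr_flagMul_zero, repr_flagMul_one, repr_flagMul_two,
    repr_flagMul_three, mul_zero, add_zero, zero_mul, zero_add, true_and]
  refine ⟨?_, ?_⟩ <;> (field_simp; ring)

theorem repr_flowW (hp : 64 < p) (hT : ∀ u v : P, u * v = flagMul T b u v) (u : P) :
    b.repr (flowW p u) 0 = b.repr u 0 ∧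
    b.repr (flowW p u) 1 = b.repr u 1 + T.c * b.repr u 0 ^ 2 / 2 ∧
    b.repr (flowW p u) 2 = b.repr u 2 + (T.q * b.repr u 0 ^ 2 + T.s * (b.repr u 0 * b.repr u 1) +
      T.t * (b.repr u 0 * b.repr u 1)) / 2 + T.s * T.c * b.repr u 0 ^ 3 / 6 := by
  obtain ⟨h2, h3, h6, -, h24⟩ := flow_ne_zero hp
  have hL := flagMul_left_nilpotent hT
  simp only [flowW_eq hp hL, hT, map_add, map_smul, Finsupp.add_apply,
    Finsupp.smul_apply, smul_eq_mul, repr_flagMul_zero, repr_flagMul_one, repr_flagMul_two,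
    repr_flagMul_three, mul_zero, add_zero, zero_mul, zero_add, true_and]
  refine ⟨?_, ?_⟩ <;> field_simp

/-- Fourfold commutators vanish, so the truncated series is the full one, and L is a representation
of the commutator Lie algebra. The proof is a comparison of coordinates. -/
theorem flowExp_bchThree (hp : 64 < p) (hT : ∀ u v : P, u * v = flagMul T b u v) (u v w : P) :
    flowExp p (bchThree p u v) w = flowExp p u (flowExp p v w) := by
  obtain ⟨hsl, hck⟩ := flagMul_isPreLie hT
  have hL := flagMul_left_nilpotent hT
  obtain ⟨h2, h3, h6, h12, -⟩ := flow_ne_zero hp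
  obtain ⟨x0, x1, x2, x3⟩ := repr_flowExp hp hT (bchThree p u v) w
  obtain ⟨y0, y1, y2, y3⟩ := repr_flowExp hp hT u (flowExp p v w)
  obtain ⟨z0, z1, z2, z3⟩ := repr_flowExp hp hT v w
  apply b.eq_of_repr_fin_four
  · rw [x0, y0, z0]
  all_goals simp only [x1, x2, x3, y1, y2, y3, z0, z1, z2, z3]
  all_goals
    simp only [bchThree, hT, map_add, map_sub, map_smul, Finsupp.add_apply, Finsupp.sub_apply,
      Finsupp.smul_apply, smul_eq_mul, repr_flagMul_zero, repr_flagMul_one, repr_flagMul_two,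
      repr_flagMul_three, mul_zero, add_zero, zero_mul, zero_add, sub_zero]
    generalize b.repr u 0 = u0, b.repr u 1 = u1, b.repr u 2 = u2
    generalize b.repr v 0 = v0, b.repr v 1 = v1, b.repr v 2 = v2
    generalize b.repr w 0 = w0, b.repr w 1 = w1, b.repr w 2 = w2, b.repr w 3 = w3
  · ring
  · field_simp
    ring
  -- Only the last coordinate needs the pre-Lie equations; all multipliers are multiples of u0*v1 -
  -- u1*v0, the factor by which the identity fails on general constants.
  · linear_combination (norm := skip) ((-1/2)*u1*v0*w0 + (1/2)*u0*v1*w0) * hck +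
      ((-1/2)*u1*v0*w1 + (1/2)*u0*v1*w1 + (-1/6)*T.c*u0*u1*v0*w0 + (-1/3)*T.c*u1*v0*v0*w0 +
        (1/6)*T.c*u0*u0*v1*w0 + (1/3)*T.c*u0*v0*v1*w0) * hsl
    field_simp
    ring

-- With a formal right unit 1, W(u) = e^{L_u}(1) - 1, so this cocycle law is the multiplicativity of
-- `flowExp` applied to 1. It says that W carries the truncated series to ∘.
set_option maxHeartbeats 1000000 in
theorem flowW_bchThree (hp : 64 < p) (hT : ∀ u v : P, u * v = flagMul T b u v) (u v : P) :
    flowW p (bchThree p u v) = flowW p u + flowExp p u (flowW p v) := by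
  obtain ⟨hsl, hck⟩ := flagMul_isPreLie hT
  have hL := flagMul_left_nilpotent hT
  obtain ⟨h2, h3, h6, h12, h24⟩ := flow_ne_zero hp
  obtain ⟨y0, y1, y2, y3⟩ := repr_flowExp hp hT u (flowW p v)
  apply b.eq_of_repr_fin_four
  all_goals simp only [map_add, Finsupp.add_apply, y0, y1, y2, y3]
  · simp [flowW_eq hp hL, bchThree, hT, repr_flagMul_zero]
  all_goals
    simp only [flowW_eq hp hL, bchThree, hT, map_add, map_sub, map_smul, Finsupp.add_apply,
      Finsupp.sub_apply,
      Finsupp.smul_apply, smul_eq_mul, repr_flagMul_zero, repr_flagMul_one, repr_flagMul_two,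
      repr_flagMul_three, mul_zero, add_zero, zero_mul, zero_add, sub_zero]
    generalize b.repr u 0 = u0, b.repr u 1 = u1, b.repr u 2 = u2, b.repr u 3 = u3
    generalize b.repr v 0 = v0, b.repr v 1 = v1, b.repr v 2 = v2, b.repr v 3 = v3
  · field_simp
    ring
  · field_simp
    ring
  · linear_combination (norm := skip)
      ((-1/6)*u0*u1*v0 + (-1/3)*u1*v0*v0 + (1/6)*u0*u0*v1 + (1/3)*u0*v0*v1) * hck +
      ((1/6)*u0*u1*v1 + (-1/6)*u1*u1*v0 + (1/3)*u0*v1*v1 + (-1/3)*u1*v0*v1 +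
        (-1/24)*T.c*u0*u0*u1*v0 + (-1/8)*T.c*u0*u1*v0*v0 + (-1/8)*T.c*u1*v0*v0*v0 +
        (1/24)*T.c*u0*u0*u0*v1 + (1/8)*T.c*u0*u0*v0*v1 + (1/8)*T.c*u0*v0*v0*v1) * hsl
    have h8 : (8 : ZMod p) ≠ 0 := by
      rw [show (8 : ZMod p) = 2 ^ 3 by norm_num]
      exact pow_ne_zero 3 h2
    field_simp
    ring

end FlagFlow

/-! ### The brace of flows of a flag algebra -/

section FlagBrace

variable {p : ℕ} [Fact p.Prime] {P : Type u} [LeftPreLieRing P] [LeftPreLieAlgebra (ZMod p) P]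
  {T : FlagConstants (ZMod p)} {b : Module.Basis (Fin 4) (ZMod p) P}

theorem flowOmega_flowW (hp : 64 < p) (hT : ∀ u v : P, u * v = flagMul T b u v) (u : P) :
    flowOmega p (flowW p u) = u :=
  Function.leftInverse_invFun (flow_injective hp hT) u

theorem flowW_surjective (hp : 64 < p) (hT : ∀ u v : P, u * v = flagMul T b u v) :
    Function.Surjective (flowW p : P → P) := by
  have : Module.Finite (ZMod p) P := Module.Finite.of_basis b
  have : Finite P := Module.finite_of_finite (ZMod p)
  exact Finite.injective_iff_surjective.1 (flow_injective hp hT)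

theorem flowW_flowOmega (hp : 64 < p) (hT : ∀ u v : P, u * v = flagMul T b u v) (a : P) :
    flowW p (flowOmega p a) = a := by
  obtain ⟨u, rfl⟩ := flowW_surjective hp hT a
  rw [flowOmega_flowW hp hT]

theorem flowCirc_flowW (hp : 64 < p) (hT : ∀ u v : P, u * v = flagMul T b u v) (u v : P) :
    flowCirc p (flowW p u) v = flowW p u + flowExp p u v := by
  rw [flowCirc, flowOmega_flowW hp hT]

theorem flowExp_add (hp : 64 < p) (hT : ∀ u v : P, u * v = flagMul T b u v) (u v w : P) :
    flowExp p u (v + w) = flowExp p u v + flowExp p u w := by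
  simp only [flowExp_eq hp (flagMul_left_nilpotent hT), mul_add, smul_add]
  abel

theorem flowExp_smul (hp : 64 < p) (hT : ∀ u v : P, u * v = flagMul T b u v) (u : P)
    (r : ZMod p) (v : P) : flowExp p u (r • v) = r • flowExp p u v := by
  simp only [flowExp_eq hp (flagMul_left_nilpotent hT), mul_smul_comm, smul_add,
    smul_comm r (_ : ZMod p)]

theorem flowExp_zero_left (hp : 64 < p) (hT : ∀ u v : P, u * v = flagMul T b u v) (v : P) :
    flowExp p 0 v = v := by
  simp [flowExp_eq hp (flagMul_left_nilpotent hT)]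

theorem flowExp_zero_right (hp : 64 < p) (hT : ∀ u v : P, u * v = flagMul T b u v) (u : P) :
    flowExp p u 0 = 0 := by
  simp [flowExp_eq hp (flagMul_left_nilpotent hT)]

theorem flowW_zero (hp : 64 < p) (hT : ∀ u v : P, u * v = flagMul T b u v) :
    flowW p (0 : P) = 0 := by
  simp [flowW_eq hp (flagMul_left_nilpotent hT)]

theorem flowExp_neg_self (hp : 64 < p) (hT : ∀ u v : P, u * v = flagMul T b u v) (u v : P) :
    flowExp p (-u) (flowExp p u v) = v := by
  rw [← flowExp_bchThree hp hT]
  simp [bchThree, flowExp_zero_left hp hT]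

theorem flowCirc_flowW_neg (hp : 64 < p) (hT : ∀ u v : P, u * v = flagMul T b u v) (u : P) :
    flowCirc p (flowW p u) (flowW p (-u)) = 0 := by
  rw [flowCirc_flowW hp hT, ← flowW_bchThree hp hT]
  simp [bchThree, flowW_zero hp hT]

theorem flag_isFBrace (hp : 64 < p) (hT : ∀ u v : P, u * v = flagMul T b u v) :
    IsFBrace (ZMod p) (flowCirc p : P → P → P) where
  circ_assoc x y z := by
    obtain ⟨u, rfl⟩ := flowW_surjective hp hT x
    obtain ⟨v, rfl⟩ := flowW_surjective hp hT y
    rw [flowCirc_flowW hp hT u, flowCirc_flowW hp hT u, ← flowW_bchThree hp hT,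
      flowCirc_flowW hp hT, flowCirc_flowW hp hT v, flowExp_bchThree hp hT, flowExp_add hp hT,
      flowW_bchThree hp hT, add_assoc]
  exists_neutral := by
    refine ⟨0, fun a => ⟨?_, ?_⟩, fun a => ?_⟩
    · conv_lhs => rw [← flowW_zero hp hT]
      rw [flowCirc_flowW hp hT, flowExp_zero_left hp hT, flowW_zero hp hT, zero_add]
    · rw [flowCirc, flowExp_zero_right hp hT, add_zero]
    · obtain ⟨u, rfl⟩ := flowW_surjective hp hT a
      refine ⟨flowW p (-u), ?_, flowCirc_flowW_neg hp hT u⟩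
      simpa using flowCirc_flowW_neg hp hT (-u)
  circ_add x y z := by
    simp only [flowCirc, flowExp_add hp hT]
    abel
  star_smul r x y := by
    simp only [braceStar, flowCirc, flowExp_smul hp hT, smul_sub, smul_add]
    abel

/-- The subspace of the elements whose first `n` coordinates are zero. -/
def flagSubmodule {K V : Type*} [CommRing K] [AddCommGroup V] [Module K V]
    (b : Module.Basis (Fin 4) K V) (n : ℕ) : Submodule K V where
  carrier := {v | ∀ i : Fin 4, i.val < n → b.repr v i = 0}
  add_mem' hu hv i hi := by simp [hu i hi, hv i hi]
  zero_mem' i _ := by simp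
  smul_mem' r u hu i hi := by simp [hu i hi]

theorem flag_isRightNilpotent (hp : 64 < p) (hT : ∀ u v : P, u * v = flagMul T b u v) :
    IsRightNilpotentBrace (flowCirc p : P → P → P) := by
  have step : ∀ n, braceRightSeries (flowCirc p : P → P → P) n ≤
      (flagSubmodule b n).toAddSubgroup := by
    intro n
    induction n with
    | zero => exact fun v _ i hi => absurd hi (by omega)
    | succ n ih =>
      rw [braceRightSeries, AddSubgroup.closure_le]
      rintro _ ⟨a, ha, v, rfl⟩ i hi
      have ha := ih ha
      change ∀ i : Fin 4, i.val < n → b.repr a i = 0 at ha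
      obtain ⟨u, rfl⟩ := flowW_surjective hp hT a
      rw [braceStar, flowCirc_flowW hp hT, add_sub_cancel_left]
      obtain ⟨w0, w1, w2⟩ := repr_flowW hp hT u
      obtain ⟨x0, x1, x2, x3⟩ := repr_flowExp hp hT u v
      simp only [map_sub, Finsupp.sub_apply]
      -- As W is unitriangular, u has as many vanishing leading coordinates as a = W(u), and then
      -- e^{L_u} - 1 has image in the next step of the flag.
      have u0 : 1 ≤ n → b.repr u 0 = 0 := fun h => by rw [← w0]; exact ha 0 h
      have u1 : 2 ≤ n → b.repr u 1 = 0 := fun h => by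
        have := ha 1 h
        rwa [w1, u0 (by omega), zero_pow two_ne_zero, mul_zero, zero_div, add_zero] at this
      have u2 : 3 ≤ n → b.repr u 2 = 0 := fun h => by
        have := ha 2 h
        rw [w2, u0 (by omega), u1 (by omega)] at this
        simpa using this
      fin_cases i
      · simp [x0]
      · simp at hi
        simp [x1, u0 hi]
      · simp at hi
        simp [x2, u0 (by omega), u1 hi]
      · simp at hi
        simp [x3, u0 (by omega), u1 (by omega), u2 hi]
  -- The series is indexed from zero: index 4 stands for A^(5).
  refine ⟨4, eq_bot_iff.2 fun v hv => ?_⟩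
  have := step 4 hv
  exact b.eq_of_repr_fin_four (by simpa using this 0 (by simp)) (by simpa using this 1 (by simp))
    (by simpa using this 2 (by simp)) (by simpa using this 3 (by simp))

/-- This is L_u = log(1 + N) with N = e^{L_u} - 1; the logarithm stops at N³ because L_u⁴ = 0. -/
theorem mul_eq_of_flowExp (hp : 64 < p) (hT : ∀ u v : P, u * v = flagMul T b u v) (u v : P)
    (N : P → P) (hN : ∀ w, N w = flowExp p u w - w) :
    u * v = N v - (2 : ZMod p)⁻¹ • N (N v) + (3 : ZMod p)⁻¹ • N (N (N v)) := by
  have hL := flagMul_left_nilpotent hT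
  obtain ⟨h2, h3, h6, h12, h24⟩ := flow_ne_zero hp
  have e : ∀ w, N w = u * w + (2 : ZMod p)⁻¹ • (u * (u * w)) +
      (6 : ZMod p)⁻¹ • (u * (u * (u * w))) := fun w => by
    rw [hN, flowExp_eq hp hL]
    abel
  simp only [e, mul_add, mul_smul_comm, hL, smul_zero, add_zero, mul_zero]
  match_scalars <;> (field_simp; try ring)

/-- Since W(u) = ((e^t - 1)/t)(u) at t = L_u, the inverse is t/(e^t - 1) = 1 - t/2 + t²/12 + 0·t³ +
⋯, whose later terms vanish. -/
theorem eq_of_flowW (hp : 64 < p) (hT : ∀ u v : P, u * v = flagMul T b u v) (u : P) :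
    u = flowW p u - (2 : ZMod p)⁻¹ • (u * flowW p u) +
      (12 : ZMod p)⁻¹ • (u * (u * flowW p u)) := by
  have hL := flagMul_left_nilpotent hT
  obtain ⟨h2, h3, h6, h12, h24⟩ := flow_ne_zero hp
  simp only [flowW_eq hp hL, mul_add, mul_smul_comm, hL, smul_zero, add_zero, mul_zero]
  match_scalars <;> (field_simp; try ring)

/-- A subbrace S is a subalgebra: if W(u) lies in S, then L_u preserves S by the logarithm, and u
lies in S by the series t/(e^t - 1). Finiteness of S reverses the last implication. -/
theorem flag_braceGeneratedBy (hp : 64 < p) (hT : ∀ u v : P, u * v = flagMul T b u v) {x : P}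
    (hx : NonUnitalAlgebra.adjoin (ZMod p) {x} = ⊤) :
    BraceGeneratedBy (flowCirc p : P → P → P) x := by
  intro S hxS hS _
  have : Module.Finite (ZMod p) P := Module.Finite.of_basis b
  have : Finite P := Module.finite_of_finite (ZMod p)
  have smul_mem : ∀ (r : ZMod p), ∀ v ∈ S, r • v ∈ S := fun r v hv => ZMod.smul_mem (K := S) hv r
  have h1 : ∀ u, flowW p u ∈ S → ∀ v ∈ S, u * v ∈ S := by
    intro u hu v hv
    have hN : ∀ w ∈ S, flowExp p u w - w ∈ S := fun w hw => by
      have := S.sub_mem (S.sub_mem (hS _ hu w hw) hu) hw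
      rwa [flowCirc_flowW hp hT, add_sub_cancel_left] at this
    rw [mul_eq_of_flowExp hp hT u v (fun w => flowExp p u w - w) (fun _ => rfl)]
    exact S.add_mem (S.sub_mem (hN _ hv) (smul_mem _ _ (hN _ (hN _ hv))))
      (smul_mem _ _ (hN _ (hN _ (hN _ hv))))
  have h2 : ∀ u, flowW p u ∈ S → u ∈ S := by
    intro u hu
    rw [eq_of_flowW hp hT u]
    exact S.add_mem (S.sub_mem hu (smul_mem _ _ (h1 u hu _ hu)))
      (smul_mem _ _ (h1 u hu _ (h1 u hu _ hu)))
  -- Ω is an injective self-map of the finite set S, hence onto: every u in S is Ω(a) with a in S,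
  -- that is, W(u) lies in S.
  let f : S → S := fun a => ⟨flowOmega p a.1, h2 _ (by rw [flowW_flowOmega hp hT]; exact a.2)⟩
  have hf : Function.Surjective f := Finite.injective_iff_surjective.1 fun a c h => by
    have := congrArg (fun z : S => flowW p z.1) h
    simp only [f, flowW_flowOmega hp hT] at this
    exact Subtype.ext this
  have h3 : ∀ u ∈ S, ∀ v ∈ S, u * v ∈ S := by
    intro u hu v hv
    obtain ⟨a, ha⟩ := hf ⟨u, hu⟩
    refine h1 u ?_ v hv
    have : u = flowOmega p a.1 := congrArg Subtype.val ha.symm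
    rw [this, flowW_flowOmega hp hT]
    exact a.2
  let B : NonUnitalSubalgebra (ZMod p) P :=
    { S with
      mul_mem' := fun {u v} hu hv => h3 u hu v hv
      smul_mem' := fun r v hv => smul_mem r v hv }
  have hB : B = ⊤ := by
    rw [← top_le_iff, ← hx]
    exact NonUnitalAlgebra.adjoin_le (Set.singleton_subset_iff.2 hxS)
  rw [eq_top_iff]
  intro v _
  exact (hB ▸ NonUnitalAlgebra.mem_top : v ∈ B)

/-- A subalgebra is stable under W and all e^{L_u}, and W permutes it because it is finite. So its
elements are W(u) with u inside, with inverses W(-u), and it is a subbrace. -/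
theorem adjoin_eq_top_of_braceGeneratedBy (hp : 64 < p)
    (hT : ∀ u v : P, u * v = flagMul T b u v) {x : P}
    (hx : BraceGeneratedBy (flowCirc p : P → P → P) x) :
    NonUnitalAlgebra.adjoin (ZMod p) {x} = ⊤ := by
  have : Module.Finite (ZMod p) P := Module.Finite.of_basis b
  have : Finite P := Module.finite_of_finite (ZMod p)
  have hL := flagMul_left_nilpotent hT
  set S := NonUnitalAlgebra.adjoin (ZMod p) {x} with hSdef
  have hW : ∀ u ∈ S, flowW p u ∈ S := fun u hu => by
    rw [flowW_eq hp hL]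
    have h2 := S.mul_mem hu hu
    have h3 := S.mul_mem hu h2
    exact S.add_mem (S.add_mem (S.add_mem hu (SMulMemClass.smul_mem _ h2))
      (SMulMemClass.smul_mem _ h3))
      (SMulMemClass.smul_mem _ (S.mul_mem hu h3))
  have hE : ∀ u ∈ S, ∀ v ∈ S, flowExp p u v ∈ S := fun u hu v hv => by
    rw [flowExp_eq hp hL]
    have h1 := S.mul_mem hu hv
    have h2 := S.mul_mem hu h1
    exact S.add_mem (S.add_mem (S.add_mem hv h1) (SMulMemClass.smul_mem _ h2))
      (SMulMemClass.smul_mem _ (S.mul_mem hu h2))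
  let f : S → S := fun a => ⟨flowW p a.1, hW _ a.2⟩
  have hf : Function.Surjective f := Finite.injective_iff_surjective.1 fun a c h =>
    Subtype.ext (flow_injective hp hT (congrArg Subtype.val h))
  have key := hx S.toAddSubgroup (NonUnitalAlgebra.self_mem_adjoin_singleton (ZMod p) x) ?_ ?_
  · rw [eq_top_iff]
    intro v _
    have : v ∈ S.toAddSubgroup := key ▸ AddSubgroup.mem_top v
    exact this
  · intro a ha v hv
    obtain ⟨u, hu⟩ := hf ⟨a, ha⟩
    obtain rfl : flowW p u.1 = a := congrArg Subtype.val hu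
    rw [flowCirc_flowW hp hT]
    exact S.add_mem ha (hE _ u.2 _ hv)
  · intro a ha v hv
    obtain ⟨u, hu⟩ := hf ⟨a, ha⟩
    obtain rfl : flowW p u.1 = a := congrArg Subtype.val hu
    have h0 := flowCirc_flowW_neg hp hT u.1
    rw [← hv, flowCirc_flowW hp hT, flowCirc_flowW hp hT] at h0
    have h1 := congrArg (flowExp p (-u.1)) (add_left_cancel h0)
    rw [flowExp_neg_self hp hT, flowExp_neg_self hp hT] at h1
    rw [← h1]
    exact hW _ (S.neg_mem u.2)

end FlagBrace

/-! ### Listed algebras are flag algebras -/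

section FlagMulLinear

variable {K V : Type*} [CommRing K] [AddCommGroup V] [Module K V]
  (T : FlagConstants K) (b : Module.Basis (Fin 4) K V)

/-- `flagMul` as a bilinear map. -/
noncomputable def flagMulₗ : V →ₗ[K] V →ₗ[K] V :=
  LinearMap.mk₂ K (flagMul T b)
    (fun u v w => by simp only [flagMul, map_add, Finsupp.add_apply]; module)
    (fun r u v => by simp only [flagMul, map_smul, Finsupp.smul_apply, smul_eq_mul]; module)
    (fun u v w => by simp only [flagMul, map_add, Finsupp.add_apply]; module)
    (fun r u v => by simp only [flagMul, map_smul, Finsupp.smul_apply, smul_eq_mul]; module)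

theorem flagMulₗ_apply (u v : V) : flagMulₗ T b u v = flagMul T b u v := rfl

end FlagMulLinear

section ListedToFlag

variable {p : ℕ} [Fact p.Prime] {P : Type u} [LeftPreLieRing P] [LeftPreLieAlgebra (ZMod p) P]

theorem mul_eq_flagMul {T : FlagConstants (ZMod p)} {b : Module.Basis (Fin 4) (ZMod p) P}
    (h00 : b 0 * b 0 = T.c • b 1 + T.q • b 2 + T.r • b 3)
    (h01 : b 0 * b 1 = T.s • b 2 + T.s' • b 3) (h10 : b 1 * b 0 = T.t • b 2 + T.t' • b 3)
    (h02 : b 0 * b 2 = T.g • b 3) (h20 : b 2 * b 0 = T.h • b 3) (h11 : b 1 * b 1 = T.k • b 3)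
    (h12 : b 1 * b 2 = T.l • b 3) (h03 : b 0 * b 3 = 0) (h13 : b 1 * b 3 = 0)
    (h21 : b 2 * b 1 = 0) (h22 : b 2 * b 2 = 0) (h23 : b 2 * b 3 = 0) (h3 : ∀ i, b 3 * b i = 0)
    (u v : P) : u * v = flagMul T b u v := by
  have : LinearMap.mul (ZMod p) P = flagMulₗ T b := by
    refine b.ext fun i => b.ext fun j => ?_
    rw [LinearMap.mul_apply', flagMulₗ_apply]
    fin_cases i <;> fin_cases j <;>
    simp [flagMul, Finsupp.single_apply, h00, h01, h10, h02, h20, h11, h12, h03, h13, h21, h22,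
      h23, h3, add_assoc]
  exact LinearMap.congr_fun (LinearMap.congr_fun this u) v

theorem IsProductOf.mem_preLiePower {m n : ℕ} {a : P} (h : IsProductOf m a) (hn : n ≤ m) :
    a ∈ preLiePower p P n :=
  Submodule.subset_span ⟨m, hn, h⟩

theorem IsProductOf.eq_zero {m n : ℕ} {a : P} (h : IsProductOf m a) (hn : n ≤ m)
    (h0 : preLiePower p P n = ⊥) : a = 0 := by
  have := h.mem_preLiePower (p := p) hn
  rwa [h0, Submodule.mem_bot] at this

theorem IsFirstType.exists_flag {x : P} {α β γ : ZMod p} (h : IsFirstType p x α β γ) :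
    ∃ (T : FlagConstants (ZMod p)) (b : Module.Basis (Fin 4) (ZMod p) P),
      ∀ u v : P, u * v = flagMul T b u v := by
  let b := Module.Basis.mk h.base.1 h.base.2.ge
  have e0 : b 0 = x := by simp [b]
  have e1 : b 1 = x * x := by simp [b]
  have e2 : b 2 = (x * x) * x := by simp [b]
  have e3 : b 3 = (x * x) * ((x * x) * x) := by simp [b]
  let o : FreeMagma Unit := FreeMagma.of ()
  have lift_mul : ∀ w w' : FreeMagma Unit, FreeMagma.lift (fun _ => x) (w * w') =
    FreeMagma.lift (fun _ => x) w * FreeMagma.lift (fun _ => x) w' := fun w w' => map_mul _ w w'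
  have lift_o : FreeMagma.lift (fun _ => x) o = x := FreeMagma.lift_of _ _
  have f1 := h.long_products (o * (o * o * (o * o * o))) (by decide) (by decide)
  have f2 := h.long_products (o * o * (o * o * (o * o * o))) (by decide) (by decide)
  have f3 := h.long_products (o * o * o * (o * o * (o * o * o))) (by decide) (by decide)
  have f4 := h.long_products (o * o * (o * o * o) * (o * o * (o * o * o))) (by decide) (by decide)
  have f5 := h.long_products (o * o * (o * o * o) * o) (by decide) (by decide)
  have f6 := h.long_products (o * o * (o * o * o) * (o * o)) (by decide) (by decide)
  have f7 := h.long_products (o * o * (o * o * o) * (o * o * o)) (by decide) (by decide)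
  have f8 := h.long_products (o * o * o * (o * o)) (by decide) (by decide)
  have f9 := h.long_products (o * o * o * (o * o * o)) (by decide) (by decide)
  simp only [lift_mul, lift_o] at f1 f2 f3 f4 f5 f6 f7 f8 f9
  -- The constants are in the order c, q, r, s, s', t, t', g, h, k, l; k = γ + β comes from the
  -- relation for x²x².
  refine ⟨⟨1, 0, 0, 0, α, 1, 0, γ, β, γ + β, 1⟩, b, mul_eq_flagMul ?_ ?_ ?_ ?_ ?_ ?_ ?_ ?_ ?_ ?_ ?_
    ?_ fun i => ?_⟩
  on_goal 13 => fin_cases i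
  all_goals simp [e0, e1, e2, e3, h.rel_α, h.rel_β, h.rel_γ, h.rel₃, f1, f2, f3, f4, f5, f6, f7,
    f8, f9, add_smul]

theorem IsSecondType.exists_flag {x a b : P} {α β δ μ : ZMod p}
    (h : IsSecondType p x a b α β δ μ) :
    ∃ (T : FlagConstants (ZMod p)) (b : Module.Basis (Fin 4) (ZMod p) P),
      ∀ u v : P, u * v = flagMul T b u v := by
  let v := Module.Basis.mk h.base.1 h.base.2.ge
  have e0 : v 0 = x := by simp [v]
  have e1 : v 1 = x * x := by simp [v]
  have e2 : v 2 = a := by simp [v]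
  have e3 : v 3 = b := by simp [v]
  have p1 := IsProductOf.single x
  have p2 := p1.mul p1
  have pa : IsProductOf 3 a := by
    rcases h.a_choice with rfl | rfl
    exacts [p1.mul p2, p2.mul p1]
  have pb : IsProductOf 4 b := by
    rcases h.b_choice with ⟨rfl, -⟩ | ⟨rfl, -⟩
    exacts [p1.mul pa, pa.mul p1]
  have z : ∀ {m : ℕ} {a : P}, IsProductOf m a → 5 ≤ m → a = 0 := fun h' hm =>
    h'.eq_zero hm h.pow_five
  have four : ∀ {a : P}, IsProductOf 4 a → ∃ r : ZMod p, a = r • b := fun {a} ha => by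
    have := ha.mem_preLiePower (p := p) le_rfl
    rw [h.pow_four_eq, Submodule.mem_span_singleton] at this
    exact this.imp fun r hr => hr.symm
  have hab : ∀ r s : ZMod p, r • a = s • b → r = 0 := fun r s hrs => by
    have := congrArg (fun w => v.repr w 2) hrs
    simpa [← e2, ← e3] using this
  have three : (∃ s s' : ZMod p, x * (x * x) = s • a + s' • b) ∧
      ∃ t t' : ZMod p, x * x * x = t • a + t' • b := by
    have hδ := h.rel_δ
    rcases h.a_choice with ha | ha <;> rw [← ha] at hδ
    · refine ⟨⟨1, 0, by simp [ha]⟩, -(β⁻¹ * α), β⁻¹ * δ, ?_⟩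
      -- With β = 0 the relation reads α a = δ b, so α = 0 by independence. Hence the relation can
      -- be solved for the cubic word that was not chosen as a.
      have hβ : β ≠ 0 := by
        rintro rfl
        rw [zero_smul, add_zero] at hδ
        exact h.not_both_zero ⟨hab _ _ hδ, rfl⟩
      rw [← eq_sub_iff_add_eq'] at hδ
      rw [← inv_smul_smul₀ hβ (x * x * x), hδ]
      module
    · refine ⟨⟨-(α⁻¹ * β), α⁻¹ * δ, ?_⟩, 1, 0, by simp [ha]⟩
      have hα : α ≠ 0 := by
        rintro rfl
        rw [zero_smul, zero_add] at hδ
        exact h.not_both_zero ⟨rfl, hab _ _ hδ⟩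
      rw [← eq_sub_iff_add_eq] at hδ
      rw [← inv_smul_smul₀ hα (x * (x * x)), hδ]
      module
  obtain ⟨⟨s, s', hs⟩, t, t', ht⟩ := three
  obtain ⟨g, hg⟩ := four (p1.mul pa)
  obtain ⟨k, hk⟩ := four (p2.mul p2)
  obtain ⟨l, hl⟩ := four (pa.mul p1)
  refine ⟨⟨1, 0, 0, s, s', t, t', g, l, k, 0⟩, v, mul_eq_flagMul ?_ ?_ ?_ ?_ ?_ ?_ ?_ ?_ ?_ ?_ ?_
    ?_ fun i => ?_⟩
  on_goal 13 => fin_cases i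
  all_goals simp [e0, e1, e2, e3, hs, ht, hg, hk, hl, z (p2.mul pa), z (p1.mul pb),
    z (p2.mul pb), z (pa.mul p2), z (pa.mul pa), z (pa.mul pb), z (pb.mul p1), z (pb.mul p2),
    z (pb.mul pa), z (pb.mul pb)]

theorem IsThirdType.exists_flag {x : P} (h : IsThirdType p x) :
    ∃ (T : FlagConstants (ZMod p)) (b : Module.Basis (Fin 4) (ZMod p) P),
      ∀ u v : P, u * v = flagMul T b u v := by
  let b := Module.Basis.mk h.base.1 h.base.2.ge
  have e0 : b 0 = x := by simp [b]
  have e1 : b 1 = x * x := by simp [b]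
  have e2 : b 2 = (x * x) * x := by simp [b]
  have e3 : b 3 = x * (x * x) := by simp [b]
  have p1 := IsProductOf.single x
  have p2 := p1.mul p1
  have p3 := p2.mul p1
  have p4 := p1.mul p2
  have z : ∀ {m : ℕ} {a : P}, IsProductOf m a → 4 ≤ m → a = 0 := fun h' hm =>
    h'.eq_zero hm h.pow_four
  refine ⟨⟨1, 0, 0, 0, 1, 1, 0, 0, 0, 0, 0⟩, b, mul_eq_flagMul ?_ ?_ ?_ ?_ ?_ ?_ ?_ ?_ ?_ ?_ ?_
    ?_ fun i => ?_⟩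
  on_goal 13 => fin_cases i
  all_goals simp [e0, e1, e2, e3, z (p1.mul p3), z (p1.mul p4), z (p2.mul p2), z (p2.mul p3),
    z (p2.mul p4), z (p3.mul p1), z (p3.mul p2), z (p3.mul p3), z (p3.mul p4), z (p4.mul p1),
    z (p4.mul p2), z (p4.mul p3), z (p4.mul p4)]

theorem IsListed.exists_flag {x : P} (h : IsListed p x) :
    IsOneGenerated p x ∧ ∃ (T : FlagConstants (ZMod p)) (b : Module.Basis (Fin 4) (ZMod p) P),
      ∀ u v : P, u * v = flagMul T b u v := by
  obtain ⟨α, β, γ, h⟩ | ⟨a, b, α, β, δ, μ, h⟩ | h := h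
  exacts [⟨h.gen, h.exists_flag⟩, ⟨h.gen, h.exists_flag⟩, ⟨h.gen, h.exists_flag⟩]

end ListedToFlag

/-! ### Flag algebras are listed -/

section FlagToListed

variable {p : ℕ} [Fact p.Prime] {P : Type u} [LeftPreLieRing P] [LeftPreLieAlgebra (ZMod p) P]
  {T : FlagConstants (ZMod p)} {e : Module.Basis (Fin 4) (ZMod p) P}

/-- A count of weights: eᵢ is reached by products of at most i + 1 factors for i ≤ 2. The vector e₃
is reached by five factors only through e₁e₂, whose coefficient is l, and never by six. -/
theorem IsProductOf.repr_flag (hT : ∀ u v : P, u * v = flagMul T e u v) {n : ℕ} {a : P}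
    (h : IsProductOf n a) : (2 ≤ n → e.repr a 0 = 0) ∧ (3 ≤ n → e.repr a 1 = 0) ∧
      (4 ≤ n → e.repr a 2 = 0) ∧ (5 ≤ n → T.l = 0 → e.repr a 3 = 0) ∧
      (4 ≤ n → T.l = 0 → T.g = 0 → T.h = 0 → T.k = 0 → e.repr a 3 = 0) ∧
      (6 ≤ n → e.repr a 3 = 0) ∧ 1 ≤ n := by
  induction h with
  | single a => simp
  | @mul m n a b _ _ iha ihb =>
    obtain ⟨a0, a1, a2, -, -, -, hm⟩ := iha
    obtain ⟨b0, b1, b2, -, -, -, hn⟩ := ihb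
    simp only [hT, repr_flagMul_zero, repr_flagMul_one, repr_flagMul_two, repr_flagMul_three]
    refine ⟨fun _ => trivial, fun h => ?_, fun h => ?_, fun h hl => ?_, fun h hl hg hh hk => ?_,
      fun h => ?_, by omega⟩
    · obtain h | h : 2 ≤ m ∨ 2 ≤ n := by omega
      · simp [a0 h]
      · simp [b0 h]
    · obtain h | h | ⟨h, h'⟩ : 3 ≤ m ∨ 3 ≤ n ∨ (2 ≤ m ∧ 2 ≤ n) := by omega
      · simp [a0 (by omega), a1 h]
      · simp [b0 (by omega), b1 h]
      · simp [a0 h, b0 h']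
    · obtain h | h | ⟨h, h'⟩ | ⟨h, h'⟩ : 4 ≤ m ∨ 4 ≤ n ∨ (2 ≤ m ∧ 3 ≤ n) ∨ (3 ≤ m ∧ 2 ≤ n) := by
        omega
      · simp [a0 (by omega), a1 (by omega), a2 h]
      · simp [b0 (by omega), b1 (by omega), b2 h]
      · simp [a0 h, b0 (by omega), b1 h', hl]
      · simp [a0 (by omega), a1 h, b0 h']
    · obtain h | h | ⟨h, h'⟩ : 3 ≤ m ∨ 3 ≤ n ∨ (2 ≤ m ∧ 2 ≤ n) := by omega
      · simp [a0 (by omega), a1 h, hh]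
      · simp [b0 (by omega), b1 h, hg, hl]
      · simp [a0 h, b0 h', hk, hl]
    · obtain h | h | ⟨h, h'⟩ : 4 ≤ m ∨ 4 ≤ n ∨ (3 ≤ m ∧ 3 ≤ n) := by omega
      · simp [a0 (by omega), a1 (by omega), a2 h]
      · simp [b0 (by omega), b1 (by omega), b2 h]
      · simp [a0 (by omega), a1 h, b0 (by omega), b1 h']

theorem IsProductOf.mem_flagSubmodule (hT : ∀ u v : P, u * v = flagMul T e u v) {m n : ℕ} {a : P}
    (h : IsProductOf m a) (hn : n ≤ m) (hn4 : n ≤ 4) : a ∈ flagSubmodule e (n - 1) := by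
  intro i hi
  obtain ⟨a0, a1, a2, -⟩ := h.repr_flag hT
  fin_cases i <;> simp at hi
  · exact a0 (by omega)
  · exact a1 (by omega)
  · exact a2 (by omega)
  · omega

theorem preLiePower_le_flagSubmodule (hT : ∀ u v : P, u * v = flagMul T e u v) {n : ℕ}
    (hn : n ≤ 4) : preLiePower p P n ≤ flagSubmodule e (n - 1) :=
  Submodule.span_le.2 fun _ ⟨_, hm, h⟩ => h.mem_flagSubmodule hT hm hn

theorem preLiePower_eq_bot (hT : ∀ u v : P, u * v = flagMul T e u v) {n : ℕ}
    (hn : (6 ≤ n) ∨ (5 ≤ n ∧ T.l = 0) ∨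
      (4 ≤ n ∧ T.l = 0 ∧ T.g = 0 ∧ T.h = 0 ∧ T.k = 0)) : preLiePower p P n = ⊥ := by
  rw [preLiePower, Submodule.span_eq_bot]
  rintro a ⟨m, hm, ha⟩
  obtain ⟨a0, a1, a2, a3, a4, a5, -⟩ := ha.repr_flag hT
  apply e.eq_of_repr_fin_four <;>
    simp only [map_zero, Finsupp.coe_zero, Pi.zero_apply]
  · exact a0 (by omega)
  · exact a1 (by omega)
  · exact a2 (by omega)
  · rcases hn with h | ⟨h, h'⟩ | ⟨h, h1, h2, h3, h4⟩
    · exact a5 (by omega)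
    · exact a3 (by omega) h'
    · exact a4 (by omega) h1 h2 h3 h4

theorem isBase_of_triangular (v : Fin 4 → P) (h0 : e.repr (v 0) 0 ≠ 0)
    (h1 : e.repr (v 1) 1 ≠ 0) (h2 : e.repr (v 2) 2 ≠ 0) (h3 : e.repr (v 3) 3 ≠ 0)
    (h10 : e.repr (v 1) 0 = 0) (h20 : e.repr (v 2) 0 = 0) (h30 : e.repr (v 3) 0 = 0)
    (h21 : e.repr (v 2) 1 = 0) (h31 : e.repr (v 3) 1 = 0) (h32 : e.repr (v 3) 2 = 0) :
    IsBase p v := by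
  have hli : LinearIndependent (ZMod p) v := by
    rw [Fintype.linearIndependent_iff]
    intro g hg
    have hg' : ∀ j, e.repr (∑ i, g i • v i) j = 0 := fun j => by rw [hg]; simp
    simp only [Fin.sum_univ_four, map_add, map_smul, Finsupp.add_apply, Finsupp.smul_apply,
      smul_eq_mul] at hg'
    have g0 : g 0 = 0 := by simpa [h10, h20, h30, h0] using hg' 0
    have g1 : g 1 = 0 := by simpa [g0, h21, h31, h1] using hg' 1
    have g2 : g 2 = 0 := by simpa [g0, g1, h32, h2] using hg' 2
    have g3 : g 3 = 0 := by simpa [g0, g1, g2, h3] using hg' 3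
    intro i
    fin_cases i <;> assumption
  exact ⟨hli, hli.span_eq_top_of_card_eq_finrank (by simp [Module.finrank_eq_card_basis e])⟩

theorem eq_smul_of_mem_flagSubmodule {z w : P} (hz : z ∈ flagSubmodule e 3)
    (hw : w ∈ flagSubmodule e 3) (hw3 : e.repr w 3 ≠ 0) :
    z = (e.repr z 3 / e.repr w 3) • w := by
  apply e.eq_of_repr_fin_four <;> simp only [map_smul, Finsupp.smul_apply, smul_eq_mul]
  · rw [hz 0 (by simp), hw 0 (by simp), mul_zero]
  · rw [hz 1 (by simp), hw 1 (by simp), mul_zero]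
  · rw [hz 2 (by simp), hw 2 (by simp), mul_zero]
  · rw [div_mul_cancel₀ _ hw3]

/-- The table contains no product involving e₃, so the last line of the flag is a two-sided
annihilator. -/
theorem mul_flagSubmodule_three (hT : ∀ u v : P, u * v = flagMul T e u v) (u : P) {z : P}
    (hz : z ∈ flagSubmodule e 3) : u * z = 0 ∧ z * u = 0 := by
  have z0 := hz 0 (by simp)
  have z1 := hz 1 (by simp)
  have z2 := hz 2 (by simp)
  constructor <;> apply e.eq_of_repr_fin_four <;>
  simp [hT, repr_flagMul_zero, repr_flagMul_one, repr_flagMul_two, repr_flagMul_three, z0, z1, z2]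

/-- This is the pre-Lie identity on (x, x², x). -/
theorem preLie_relation (x : P) : (x * x * x) * x - (x * (x * x)) * x =
    (x * x) * (x * x) - x * ((x * x) * x) := by
  have := LeftPreLieRing.assoc_symm x (x * x) x
  rw [associator, associator] at this
  rw [sub_eq_sub_iff_add_eq_add] at this ⊢
  rw [← this.symm.trans (add_comm _ _)]

/-- The words of length at most three in one letter. -/
theorem FreeMagma.unit_cases (w : FreeMagma Unit) (h : w.length ≤ 3) :
    w = of () ∨ w = of () * of () ∨ w = of () * (of () * of ()) ∨ w = of () * of () * of () := by
  have one : ∀ w : FreeMagma Unit, w.length ≤ 1 → w = of () := by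
    intro w hw
    induction w using FreeMagma.recOnMul with
    | ih1 x => rfl
    | ih2 x y _ _ =>
      have h1 := x.length_pos
      have h2 := y.length_pos
      change x.length + y.length ≤ 1 at hw
      omega
  have two : ∀ w : FreeMagma Unit, w.length ≤ 2 → w = of () ∨ w = of () * of () := by
    intro w hw
    induction w using FreeMagma.recOnMul with
    | ih1 x => exact Or.inl rfl
    | ih2 x y _ _ =>
      have h1 := x.length_pos
      have h2 := y.length_pos
      change x.length + y.length ≤ 2 at hw
      rw [one x (by omega), one y (by omega)]
      exact Or.inr rfl
  induction w using FreeMagma.recOnMul with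
  | ih1 x => exact Or.inl rfl
  | ih2 x y _ _ =>
    have h1 := x.length_pos
    have h2 := y.length_pos
    change x.length + y.length ≤ 3 at h
    obtain h | h : x.length ≤ 1 ∨ y.length ≤ 1 := by omega
    · rw [one x h]
      rcases two y (by omega) with rfl | rfl <;> simp
    · rw [one y h]
      rcases two x (by omega) with rfl | rfl <;> simp

theorem isProductOf_lift (x : P) (w : FreeMagma Unit) :
    IsProductOf w.length (FreeMagma.lift (fun _ => x) w) := by
  induction w using FreeMagma.recOnMul with
  | ih1 _ => exact IsProductOf.single x
  | ih2 u v hu hv =>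
    rw [map_mul]
    exact hu.mul hv

/-- The four products of the generator, in coordinates. -/
theorem repr_words (hT : ∀ u v : P, u * v = flagMul T e u v) :
    (e.repr (e 0 * e 0) 0 = 0 ∧ e.repr (e 0 * e 0) 1 = T.c) ∧
    (e.repr (e 0 * (e 0 * e 0)) 0 = 0 ∧ e.repr (e 0 * (e 0 * e 0)) 1 = 0 ∧
      e.repr (e 0 * (e 0 * e 0)) 2 = T.s * T.c) ∧
    (e.repr (e 0 * e 0 * e 0) 0 = 0 ∧ e.repr (e 0 * e 0 * e 0) 1 = 0 ∧
      e.repr (e 0 * e 0 * e 0) 2 = T.t * T.c) := by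
  simp [hT, repr_flagMul_zero, repr_flagMul_one, repr_flagMul_two, repr_flagMul_three]

theorem isFirstType_of_flag (hT : ∀ u v : P, u * v = flagMul T e u v)
    (hgen : IsOneGenerated p (e 0)) (hc : T.c ≠ 0) (ht : T.t ≠ 0) (hl : T.l ≠ 0)
    {α β γ : ZMod p} (hα : e 0 * (e 0 * e 0) = α • ((e 0 * e 0) * ((e 0 * e 0) * e 0)))
    (hβ : ((e 0 * e 0) * e 0) * e 0 = β • ((e 0 * e 0) * ((e 0 * e 0) * e 0)))
    (hγ : e 0 * ((e 0 * e 0) * e 0) = γ • ((e 0 * e 0) * ((e 0 * e 0) * e 0))) :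
    IsFirstType p (e 0) α β γ := by
  have hs : T.s = 0 := (mul_eq_zero.1 (flagMul_isPreLie hT).s_mul_l).resolve_right hl
  obtain ⟨⟨y0, y1⟩, ⟨l0, l1, l2⟩, ⟨r0, r1, r2⟩⟩ := repr_words hT
  have p1 := IsProductOf.single (e 0)
  have p5 := (p1.mul p1).mul ((p1.mul p1).mul p1)
  have w3 : e.repr ((e 0 * e 0) * ((e 0 * e 0) * e 0)) 3 = T.l * (T.c * (T.t * T.c)) := by
    rw [hT (e 0 * e 0), repr_flagMul_three, y0, y1, r0, r1, r2]
    ring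
  have w3' : T.l * (T.c * (T.t * T.c)) ≠ 0 := by simp [hl, hc, ht]
  have mem3 : e 0 * (e 0 * e 0) ∈ flagSubmodule e 3 := fun i hi => by
    fin_cases i
    exacts [l0, l1, by simp [l2, hs], absurd hi (by simp)]
  have h6 := preLiePower_eq_bot hT (Or.inl (le_refl 6))
  refine ⟨hgen, fun h => ?_, h6, ?_, fun w hw hne => ?_, (mul_flagSubmodule_three hT _ mem3).1,
    (mul_flagSubmodule_three hT _ mem3).2, ?_, hα, hβ, hγ⟩
  · rw [p5.eq_zero (by norm_num) h] at w3
    simp [w3.symm] at w3'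
  · have w4 := p5.mem_flagSubmodule hT (n := 4) (by norm_num) le_rfl
    exact isBase_of_triangular _ (by simp) (by simpa [y1] using hc) (by simp [r2, hc, ht])
      (by simpa [w3] using w3') y0 r0 (w4 0 (by simp)) r1 (w4 1 (by simp)) (w4 2 (by simp))
  · have hw' := isProductOf_lift (e 0) w
    by_cases h : 6 ≤ w.length
    · exact hw'.eq_zero h h6
    · induction w using FreeMagma.recOnMul with
      | ih1 x => exact absurd hw (by simp [FreeMagma.length])
      | ih2 u v _ _ =>
        have h1 := u.length_pos
        have h2 := v.length_pos
        have hu := isProductOf_lift (e 0) u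
        have hv := isProductOf_lift (e 0) v
        change 5 ≤ u.length + v.length at hw
        change ¬ 6 ≤ u.length + v.length at h
        rw [map_mul]
        -- A factor of length at least four lies on the annihilating last line; lengths (3, 2) give
        -- zero since e₂e₁ = 0. For (2, 3) the second factor is either x²x, which is the excluded
        -- word, or xx², which lies on the last line because s = 0.
        obtain h3 | h3 | h3 | h3 : 4 ≤ u.length ∨ 4 ≤ v.length ∨
          (u.length = 3 ∧ v.length = 2) ∨ (u.length = 2 ∧ v.length = 3) := by omega
        · exact (mul_flagSubmodule_three hT _ (hu.mem_flagSubmodule hT h3 le_rfl)).2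
        · exact (mul_flagSubmodule_three hT _ (hv.mem_flagSubmodule hT h3 le_rfl)).1
        · obtain ⟨u0, u1, -⟩ := hu.repr_flag hT
          obtain ⟨v0, -⟩ := hv.repr_flag hT
          apply e.eq_of_repr_fin_four <;>
          simp [hT, repr_flagMul_zero, repr_flagMul_one, repr_flagMul_two, repr_flagMul_three,
            u0 (by omega), u1 (by omega), v0 (by omega)]
        · obtain rfl : u = FreeMagma.of () * FreeMagma.of () := by
            rcases u.unit_cases (by omega) with rfl | rfl | rfl | rfl
            all_goals first | rfl | (simp [FreeMagma.length] at h3)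
          obtain rfl : v = FreeMagma.of () * (FreeMagma.of () * FreeMagma.of ()) := by
            rcases v.unit_cases (by omega) with rfl | rfl | rfl | rfl
            all_goals first | rfl | exact absurd rfl hne | (simp [FreeMagma.length] at h3)
          simp only [map_mul, FreeMagma.lift_of]
          exact (mul_flagSubmodule_three hT _ mem3).1
  · have := preLie_relation (e 0)
    rw [(mul_flagSubmodule_three hT _ mem3).2, sub_zero, eq_sub_iff_add_eq'] at this
    exact this.symm

theorem isSecondType_of_flag (hT : ∀ u v : P, u * v = flagMul T e u v)
    (hgen : IsOneGenerated p (e 0)) (hc : T.c ≠ 0) (hl : T.l = 0) {a b : P} {α β δ μ : ZMod p}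
    (ha : a = e 0 * (e 0 * e 0) ∨ a = (e 0 * e 0) * e 0)
    (hb : (b = e 0 * a ∧ a * e 0 = μ • b) ∨ (b = a * e 0 ∧ e 0 * a = μ • b))
    (ha2 : e.repr a 2 ≠ 0) (hb3 : e.repr b 3 ≠ 0) (hne : ¬(α = 0 ∧ β = 0))
    (hδ : α • (e 0 * (e 0 * e 0)) + β • ((e 0 * e 0) * e 0) = δ • b) :
    IsSecondType p (e 0) a b α β δ μ := by
  obtain ⟨⟨y0, y1⟩, -⟩ := repr_words hT
  have p1 := IsProductOf.single (e 0)
  have p2 := p1.mul p1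
  have pa : IsProductOf 3 a := by
    rcases ha with rfl | rfl
    exacts [p1.mul p2, p2.mul p1]
  have pb : IsProductOf 4 b := by
    rcases hb with ⟨rfl, -⟩ | ⟨rfl, -⟩
    exacts [p1.mul pa, pa.mul p1]
  have ma := pa.mem_flagSubmodule hT (n := 3) le_rfl (by norm_num)
  have mb := pb.mem_flagSubmodule hT (n := 4) le_rfl le_rfl
  have h5 : preLiePower p P 5 = ⊥ := preLiePower_eq_bot hT (Or.inr (Or.inl ⟨le_rfl, hl⟩))
  have hbase : IsBase p ![e 0, e 0 * e 0, a, b] :=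
    isBase_of_triangular _ (by simp) (by simpa [y1] using hc) (by simpa using ha2)
      (by simpa using hb3) y0 (ma 0 (by simp)) (mb 0 (by simp)) (ma 1 (by simp))
      (mb 1 (by simp)) (mb 2 (by simp))
  have four : ∀ z ∈ flagSubmodule e 3, z ∈ Submodule.span (ZMod p) {b} := fun z hz => by
    rw [eq_smul_of_mem_flagSubmodule hz mb hb3]
    exact Submodule.smul_mem _ _ (Submodule.mem_span_singleton_self b)
  have p4 : preLiePower p P 4 = Submodule.span (ZMod p) {b} := by
    refine le_antisymm (fun z hz => four z (preLiePower_le_flagSubmodule hT le_rfl hz)) ?_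
    rw [Submodule.span_singleton_le_iff_mem]
    exact pb.mem_preLiePower le_rfl
  refine ⟨hgen, fun h => ?_, h5, hbase, ha, hb, fun i => ?_, p4, preLie_relation _, hne, hδ, ?_, ?_⟩
  · rw [pb.eq_zero le_rfl h] at hb3
    simp at hb3
  · refine le_antisymm ?_ (Submodule.span_le.2 Set.inter_subset_right)
    have mem : ∀ {m : ℕ} {z : P}, z ∈ ({e 0, e 0 * e 0, a, b} : Set P) → IsProductOf m z → i ≤ m →
        z ∈ Submodule.span (ZMod p)
          (({e 0, e 0 * e 0, a, b} : Set P) ∩ (preLiePower p P i : Set P)) :=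
      fun hz hm hi => Submodule.subset_span ⟨hz, hm.mem_preLiePower hi⟩
    by_cases hi : 5 ≤ i
    · have : preLiePower p P i = ⊥ := preLiePower_eq_bot hT (Or.inr (Or.inl ⟨hi, hl⟩))
      rw [this]
      exact bot_le
    have mb' := mem (by simp) pb (by omega)
    intro z hz
    have hz := preLiePower_le_flagSubmodule hT (by omega) hz
    obtain rfl | rfl | rfl | hi : i = 4 ∨ i = 3 ∨ i = 2 ∨ i ≤ 1 := by omega
    · exact (Submodule.span_singleton_le_iff_mem b _).2 mb' (four z hz)
    · have ma' := mem (by simp) pa (by omega)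
      have : z - (e.repr z 2 / e.repr a 2) • a ∈ flagSubmodule e 3 := fun i hi => by
        fin_cases i
        · simpa [ma 0] using hz 0 (by simp)
        · simpa [ma 1] using hz 1 (by simp)
        · simp [ha2]
        · simp at hi
      rw [← sub_add_cancel z ((e.repr z 2 / e.repr a 2) • a)]
      exact Submodule.add_mem _ ((Submodule.span_singleton_le_iff_mem b _).2 mb' (four _ this))
        (Submodule.smul_mem _ _ ma')
    · have ma' := mem (by simp) pa (by omega)
      have my' := mem (by simp) p2 (by omega)
      set r := e.repr z 1 / T.c with hr
      set z' := z - r • (e 0 * e 0) with hz'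
      have hz'0 : e.repr z' 0 = 0 := by simpa [hz', y0] using hz 0 (by simp)
      have hz'1 : e.repr z' 1 = 0 := by simp [hz', y1, hr, hc]
      have : z' - (e.repr z' 2 / e.repr a 2) • a ∈ flagSubmodule e 3 := fun i hi => by
        fin_cases i
        · simpa [ma 0] using hz'0
        · simpa [ma 1] using hz'1
        · simp [ha2]
        · simp at hi
      rw [← sub_add_cancel z (r • (e 0 * e 0)), ← hz',
        ← sub_add_cancel z' ((e.repr z' 2 / e.repr a 2) • a)]
      exact Submodule.add_mem _ (Submodule.add_mem _
        ((Submodule.span_singleton_le_iff_mem b _).2 mb' (four _ this))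
        (Submodule.smul_mem _ _ ma')) (Submodule.smul_mem _ _ my')
    · have hle : Set.range ![e 0, e 0 * e 0, a, b] ⊆ Submodule.span (ZMod p)
          (({e 0, e 0 * e 0, a, b} : Set P) ∩ (preLiePower p P i : Set P)) := by
        rintro _ ⟨j, rfl⟩
        fin_cases j
        exacts [mem (by simp) p1 hi, mem (by simp) p2 (by omega), mem (by simp) pa (by omega), mb']
      exact Submodule.span_le.2 hle (hbase.2.ge Submodule.mem_top)
  · simpa only [mul_add, mul_smul_comm, (mul_flagSubmodule_three hT _ mb).1, smul_zero]
      using congrArg (fun z => e 0 * z) hδ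
  · simpa only [add_mul, smul_mul_assoc, (mul_flagSubmodule_three hT _ mb).2, smul_zero]
      using congrArg (fun z => z * e 0) hδ

/-- The pre-Lie equation gives c k = 0, so all products of four elements vanish. The span of the
four words is therefore a subalgebra containing the generator, hence everything, and four spanning
vectors in dimension four are independent. -/
theorem isThirdType_of_flag (hT : ∀ u v : P, u * v = flagMul T e u v)
    (hgen : IsOneGenerated p (e 0)) (hc : T.c ≠ 0) (hl : T.l = 0) (hg : T.g = 0) (hh : T.h = 0) :
    IsThirdType p (e 0) := by
  have hk : T.k = 0 := by
    have := (flagMul_isPreLie hT).c_mul_k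
    rw [hl, hg, hh] at this
    simpa [hc] using this
  have h4 : preLiePower p P 4 = ⊥ :=
    preLiePower_eq_bot hT (Or.inr (Or.inr ⟨le_rfl, hl, hg, hh, hk⟩))
  refine ⟨hgen, h4, ?_⟩
  set v : Fin 4 → P := ![e 0, e 0 * e 0, (e 0 * e 0) * e 0, e 0 * (e 0 * e 0)] with hv
  have p1 := IsProductOf.single (e 0)
  have p2 := p1.mul p1
  have pv : ∀ i, ∃ n, (i ≠ 0 → 2 ≤ n) ∧ (i ≠ 0 → i ≠ 1 → 3 ≤ n) ∧ 1 ≤ n ∧ IsProductOf n (v i) := by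
    intro i
    fin_cases i
    · exact ⟨1, by simp, by simp, le_rfl, p1⟩
    · exact ⟨_, by simp, by simp, by simp, p2⟩
    · exact ⟨_, by simp, by simp, by simp, p2.mul p1⟩
    · exact ⟨_, by simp, by simp, by simp, p1.mul p2⟩
  have hmul : ∀ i j, v i * v j ∈ Submodule.span (ZMod p) (Set.range v) := by
    intro i j
    have hz : (i ≠ 0 ∧ i ≠ 1) ∨ (j ≠ 0 ∧ j ≠ 1) ∨ (i ≠ 0 ∧ j ≠ 0) → v i * v j = 0 := by
      obtain ⟨m, hm2, hm3, hm1, hm⟩ := pv i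
      obtain ⟨n, hn2, hn3, hn1, hn⟩ := pv j
      intro h
      refine (hm.mul hn).eq_zero ?_ h4
      rcases h with ⟨h, h'⟩ | ⟨h, h'⟩ | ⟨h, h'⟩
      · have := hm3 h h'
        omega
      · have := hn3 h h'
        omega
      · have := hm2 h
        have := hn2 h'
        omega
    by_cases h : (i ≠ 0 ∧ i ≠ 1) ∨ (j ≠ 0 ∧ j ≠ 1) ∨ (i ≠ 0 ∧ j ≠ 0)
    · rw [hz h]
      exact Submodule.zero_mem _
    · have : (i = 0 ∧ j = 0) ∨ (i = 0 ∧ j = 1) ∨ (i = 1 ∧ j = 0) := by omega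
      rcases this with ⟨rfl, rfl⟩ | ⟨rfl, rfl⟩ | ⟨rfl, rfl⟩
      · exact Submodule.subset_span ⟨1, rfl⟩
      · exact Submodule.subset_span ⟨3, rfl⟩
      · exact Submodule.subset_span ⟨2, rfl⟩
  let S : NonUnitalSubalgebra (ZMod p) P :=
    { Submodule.span (ZMod p) (Set.range v) with
      mul_mem' := fun {a b} ha hb => by
        change a ∈ Submodule.span (ZMod p) (Set.range v) at ha
        change b ∈ Submodule.span (ZMod p) (Set.range v) at hb
        change a * b ∈ Submodule.span (ZMod p) (Set.range v)
        induction ha using Submodule.span_induction with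
        | mem a ha =>
          obtain ⟨i, rfl⟩ := ha
          induction hb using Submodule.span_induction with
          | mem b hb =>
            obtain ⟨j, rfl⟩ := hb
            exact hmul i j
          | zero => rw [mul_zero]; exact Submodule.zero_mem _
          | add b b' _ _ h h' => rw [mul_add]; exact Submodule.add_mem _ h h'
          | smul r b _ h => rw [mul_smul_comm]; exact Submodule.smul_mem _ _ h
        | zero => rw [zero_mul]; exact Submodule.zero_mem _
        | add a a' _ _ h h' => rw [add_mul]; exact Submodule.add_mem _ h h'
        | smul r a _ h => rw [smul_mul_assoc]; exact Submodule.smul_mem _ _ h }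
  have hS : S = ⊤ := by
    rw [← top_le_iff, ← hgen.2]
    exact NonUnitalAlgebra.adjoin_le
      (Set.singleton_subset_iff.2 (Submodule.subset_span ⟨0, rfl⟩))
  have hspan : Submodule.span (ZMod p) (Set.range v) = ⊤ := by
    rw [eq_top_iff]
    intro z _
    exact (hS ▸ NonUnitalAlgebra.mem_top : z ∈ S)
  exact ⟨linearIndependent_of_top_le_span_of_card_eq_finrank hspan.ge
    (by simp [Module.finrank_eq_card_basis e]), hspan⟩

/-- If l ≠ 0, then s l = 0 forces s = 0, so t ≠ 0 and x²(x²x) spans the last line. If l = 0, the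
fourth power is zero or not according to whether g = h = 0. -/
theorem isListed_of_flag (hT : ∀ u v : P, u * v = flagMul T e u v)
    (hgen : IsOneGenerated p (e 0)) (hc : T.c ≠ 0) (hst : ¬(T.s = 0 ∧ T.t = 0)) :
    IsListed p (e 0) := by
  obtain ⟨⟨y0, y1⟩, ⟨l0, l1, l2⟩, ⟨r0, r1, r2⟩⟩ := repr_words hT
  have p1 := IsProductOf.single (e 0)
  have p2 := p1.mul p1
  by_cases hl : T.l = 0
  · by_cases hgh : T.g = 0 ∧ T.h = 0
    · exact Or.inr (Or.inr (isThirdType_of_flag hT hgen hc hl hgh.1 hgh.2))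
    · refine Or.inr (Or.inl ?_)
      obtain ⟨a, ha, ha2, pa⟩ : ∃ a, (a = e 0 * (e 0 * e 0) ∨ a = (e 0 * e 0) * e 0) ∧
          e.repr a 2 ≠ 0 ∧ IsProductOf 3 a := by
        by_cases hs : T.s = 0
        · exact ⟨_, Or.inr rfl, by simpa [r2, hc] using fun h => hst ⟨hs, h⟩, p2.mul p1⟩
        · exact ⟨_, Or.inl rfl, by simpa [l2, hc] using hs, p1.mul p2⟩
      have ma := pa.mem_flagSubmodule hT (n := 3) le_rfl (by norm_num)
      have xa : e.repr (e 0 * a) 3 = T.g * e.repr a 2 := by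
        rw [hT, repr_flagMul_three, ma 0 (by simp), ma 1 (by simp)]
        simp
      have ax : e.repr (a * e 0) 3 = T.h * e.repr a 2 := by
        rw [hT, repr_flagMul_three, ma 0 (by simp), ma 1 (by simp)]
        simp
      have mxa := (p1.mul pa).mem_flagSubmodule hT (n := 4) le_rfl le_rfl
      have max := (pa.mul p1).mem_flagSubmodule hT (n := 4) le_rfl le_rfl
      obtain ⟨b, μ, hb, hb3, mb⟩ : ∃ (b : P) (μ : ZMod p),
          ((b = e 0 * a ∧ a * e 0 = μ • b) ∨ (b = a * e 0 ∧ e 0 * a = μ • b)) ∧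
          e.repr b 3 ≠ 0 ∧ b ∈ flagSubmodule e 3 := by
        by_cases hg : T.g = 0
        · have hb3 : e.repr (a * e 0) 3 ≠ 0 := by
            rw [ax]
            exact mul_ne_zero (fun hh => hgh ⟨hg, hh⟩) ha2
          exact ⟨_, _, Or.inr ⟨rfl, eq_smul_of_mem_flagSubmodule mxa max hb3⟩, hb3, max⟩
        · have hb3 : e.repr (e 0 * a) 3 ≠ 0 := by
            rw [xa]
            exact mul_ne_zero hg ha2
          exact ⟨_, _, Or.inl ⟨rfl, eq_smul_of_mem_flagSubmodule max mxa hb3⟩, hb3, mxa⟩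
      -- The e₂-coordinates of xx² and x²x are s c and t c, so (α, β) = (t, -s) cancels them and
      -- leaves a multiple of b.
      have mδ : T.t • (e 0 * (e 0 * e 0)) + (-T.s) • (e 0 * e 0 * e 0) ∈ flagSubmodule e 3 := by
        intro i hi
        fin_cases i
        · simp [l0, r0]
        · simp [l1, r1]
        · simp [l2, r2]
          ring
        · simp at hi
      exact ⟨a, b, _, _, _, μ, isSecondType_of_flag hT hgen hc hl ha hb ha2 hb3
        (fun h => hst ⟨neg_eq_zero.1 h.2, h.1⟩) (eq_smul_of_mem_flagSubmodule mδ mb hb3)⟩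
  · have hs : T.s = 0 := (mul_eq_zero.1 (flagMul_isPreLie hT).s_mul_l).resolve_right hl
    have ht : T.t ≠ 0 := fun ht => hst ⟨hs, ht⟩
    have p5 := p2.mul (p2.mul p1)
    have w4 := p5.mem_flagSubmodule hT (n := 4) (by norm_num) le_rfl
    have w3 : e.repr ((e 0 * e 0) * ((e 0 * e 0) * e 0)) 3 ≠ 0 := by
      rw [hT (e 0 * e 0), repr_flagMul_three, y0, y1, r0, r1, r2]
      simp [hl, hc, ht]
    have mem3 : e 0 * (e 0 * e 0) ∈ flagSubmodule e 3 := fun i hi => by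
      fin_cases i
      exacts [l0, l1, by simp [l2, hs], absurd hi (by simp)]
    exact Or.inl ⟨_, _, _, isFirstType_of_flag hT hgen hc ht hl
      (eq_smul_of_mem_flagSubmodule mem3 w4 w3)
      (eq_smul_of_mem_flagSubmodule
        (((p2.mul p1).mul p1).mem_flagSubmodule hT (n := 4) le_rfl le_rfl) w4 w3)
      (eq_smul_of_mem_flagSubmodule
        ((p1.mul (p2.mul p1)).mem_flagSubmodule hT (n := 4) le_rfl le_rfl) w4 w3)⟩

end FlagToListed

/-! ### Construction of flag algebras -/

section FlagAlgebra

variable {p : ℕ} {V : Type u} [AddCommGroup V] [Module (ZMod p) V]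

/-- The space `V` with the pre-Lie multiplication with structure constants `T` in the basis `b`. -/
def FlagAlgebra (T : FlagConstants (ZMod p)) (_ : T.IsPreLie)
    (_ : Module.Basis (Fin 4) (ZMod p) V) : Type u := V

variable (T : FlagConstants (ZMod p)) (hT : T.IsPreLie) (b : Module.Basis (Fin 4) (ZMod p) V)

instance : AddCommGroup (FlagAlgebra T hT b) := inferInstanceAs (AddCommGroup V)

instance : Module (ZMod p) (FlagAlgebra T hT b) := inferInstanceAs (Module (ZMod p) V)

/-- The identity map from `V` to the flag algebra. -/
def FlagAlgebra.equiv : V ≃ₗ[ZMod p] FlagAlgebra T hT b := LinearEquiv.refl (ZMod p) V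

/-- The basis `b` as a basis of the flag algebra. -/
noncomputable def FlagAlgebra.basis : Module.Basis (Fin 4) (ZMod p) (FlagAlgebra T hT b) :=
  b.map (FlagAlgebra.equiv T hT b)

noncomputable instance : LeftPreLieRing (FlagAlgebra T hT b) :=
  { (inferInstance : AddCommGroup (FlagAlgebra T hT b)) with
    mul := flagMul T (FlagAlgebra.basis T hT b)
    left_distrib := fun u v w => map_add (flagMulₗ T (FlagAlgebra.basis T hT b) u) v w
    right_distrib := fun u v w =>
      LinearMap.map_add₂ (flagMulₗ T (FlagAlgebra.basis T hT b)) u v w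
    zero_mul := fun u => LinearMap.map_zero₂ (flagMulₗ T (FlagAlgebra.basis T hT b)) u
    mul_zero := fun u => map_zero (flagMulₗ T (FlagAlgebra.basis T hT b) u)
    assoc_symm' := fun u v w => by
      change flagMul T (FlagAlgebra.basis T hT b) (flagMul T (FlagAlgebra.basis T hT b) u v) w -
        flagMul T (FlagAlgebra.basis T hT b) u (flagMul T (FlagAlgebra.basis T hT b) v w) =
        flagMul T (FlagAlgebra.basis T hT b) (flagMul T (FlagAlgebra.basis T hT b) v u) w -
        flagMul T (FlagAlgebra.basis T hT b) v (flagMul T (FlagAlgebra.basis T hT b) u w)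
      generalize FlagAlgebra.basis T hT b = e
      obtain ⟨h1, h2⟩ := hT
      apply e.eq_of_repr_fin_four <;>
      simp only [map_sub, Finsupp.sub_apply, repr_flagMul_zero, repr_flagMul_one,
        repr_flagMul_two, repr_flagMul_three]
      · ring
      · ring
      -- The defect of the identity is alternating in u, v and sees only their first two
      -- coordinates, whence the determinant.
      · linear_combination (e.repr u 0 * e.repr v 1 - e.repr v 0 * e.repr u 1) *
          (e.repr w 0 * h2 + e.repr w 1 * h1) }

noncomputable instance : LeftPreLieAlgebra (ZMod p) (FlagAlgebra T hT b) :=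
  { (inferInstance : Module (ZMod p) (FlagAlgebra T hT b)) with
    smul_assoc := fun r u v => LinearMap.map_smul₂ (flagMulₗ T (FlagAlgebra.basis T hT b)) r u v
    smul_comm := fun r u v => (map_smul (flagMulₗ T (FlagAlgebra.basis T hT b) u) r v).symm }

theorem FlagAlgebra.mul_eq (u v : FlagAlgebra T hT b) :
    u * v = flagMul T (FlagAlgebra.basis T hT b) u v := rfl

end FlagAlgebra

/-! ### Consistency of the list -/

section Consistency

variable {p : ℕ} [Fact p.Prime] {P : Type u} [LeftPreLieRing P] [LeftPreLieAlgebra (ZMod p) P]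

theorem isOneGenerated_of_isBase {x : P} (v : Fin 4 → P) (hv : IsBase p v)
    (h : ∀ i, v i ∈ NonUnitalAlgebra.adjoin (ZMod p) {x}) : IsOneGenerated p x := by
  let b := Module.Basis.mk hv.1 hv.2.ge
  refine ⟨?_, ?_⟩
  · rw [Nat.card_congr b.equivFun.toEquiv]
    simp [Nat.card_eq_fintype_card]
  · rw [eq_top_iff]
    intro z _
    have : Submodule.span (ZMod p) (Set.range v) ≤
        (NonUnitalAlgebra.adjoin (ZMod p) {x}).toSubmodule :=
      Submodule.span_le.2 (by rintro _ ⟨i, rfl⟩; exact h i)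
    exact this (hv.2.ge Submodule.mem_top)

theorem exists_isFirstType (α β γ : ZMod p) :
    ∃ (P : Type) (_ : LeftPreLieRing P) (_ : LeftPreLieAlgebra (ZMod p) P) (x : P),
      IsFirstType p x α β γ := by
  -- With c = t = 1 and q = s = 0, the second pre-Lie equation forces k = h + g = β + γ.
  let T : FlagConstants (ZMod p) := ⟨1, 0, 0, 0, α, 1, 0, γ, β, β + γ, 1⟩
  have hT : T.IsPreLie := ⟨by simp [T], by simp [T]⟩
  let e := FlagAlgebra.basis T hT (Pi.basisFun (ZMod p) (Fin 4))
  have hm : ∀ u v, u * v = flagMul T e u v := FlagAlgebra.mul_eq T hT _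
  have h0 : e 0 * e 0 = e 1 := by simp [hm, flagMul, T]
  have h1 : e 0 * e 1 = α • e 3 := by simp [hm, flagMul, T]
  have h2 : e 1 * e 0 = e 2 := by simp [hm, flagMul, T]
  have h3 : e 1 * e 2 = e 3 := by simp [hm, flagMul, T]
  have h4 : e 2 * e 0 = β • e 3 := by simp [hm, flagMul, T]
  have h5 : e 0 * e 2 = γ • e 3 := by simp [hm, flagMul, T]
  refine ⟨_, _, inferInstance, e 0, isFirstType_of_flag hm ?_ one_ne_zero one_ne_zero one_ne_zero
    (by simp only [h0, h1, h2, h3]) (by simp only [h0, h2, h3, h4])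
    (by simp only [h0, h2, h3, h5])⟩
  refine isOneGenerated_of_isBase e
    (isBase_of_triangular (e := e) e (by simp) (by simp) (by simp) (by simp) (by simp) (by simp)
      (by simp) (by simp) (by simp) (by simp)) fun i => ?_
  have m0 := NonUnitalAlgebra.self_mem_adjoin_singleton (ZMod p) (e 0)
  have m1 := mul_mem m0 m0
  have m2 := mul_mem m1 m0
  have m3 := mul_mem m1 m2
  simp only [h0, h2, h3] at m1 m2 m3
  fin_cases i <;> assumption

theorem exists_flag_of_length_four (s s' t t' g h : ZMod p)
    (hst : (s = 1 ∧ s' = 0) ∨ (t = 1 ∧ t' = 0)) (hgh : g = 1 ∨ h = 1) :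
    ∃ (P : Type) (_ : LeftPreLieRing P) (_ : LeftPreLieAlgebra (ZMod p) P)
      (T : FlagConstants (ZMod p)) (e : Module.Basis (Fin 4) (ZMod p) P),
      (∀ u v : P, u * v = flagMul T e u v) ∧ T.c = 1 ∧ T.l = 0 ∧ IsOneGenerated p (e 0) ∧
      e 0 * e 0 = e 1 ∧ e 0 * e 1 = s • e 2 + s' • e 3 ∧ e 1 * e 0 = t • e 2 + t' • e 3 ∧
      e 0 * e 2 = g • e 3 ∧ e 2 * e 0 = h • e 3 := by
  -- With c = 1 and l = 0 the first pre-Lie equation is empty and the second one is the definition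
  -- of k.
  let T : FlagConstants (ZMod p) := ⟨1, 0, 0, s, s', t, t', g, h, t * h + t * g - s * h, 0⟩
  have hT : T.IsPreLie := ⟨by simp [T], by simp [T]⟩
  let e := FlagAlgebra.basis T hT (Pi.basisFun (ZMod p) (Fin 4))
  have hm : ∀ u v, u * v = flagMul T e u v := FlagAlgebra.mul_eq T hT _
  have h0 : e 0 * e 0 = e 1 := by simp [hm, flagMul, T]
  have h1 : e 0 * e 1 = s • e 2 + s' • e 3 := by simp [hm, flagMul, T]
  have h2 : e 1 * e 0 = t • e 2 + t' • e 3 := by simp [hm, flagMul, T]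
  have h3 : e 0 * e 2 = g • e 3 := by simp [hm, flagMul, T]
  have h4 : e 2 * e 0 = h • e 3 := by simp [hm, flagMul, T]
  refine ⟨_, _, inferInstance, T, e, hm, rfl, rfl, ?_, h0, h1, h2, h3, h4⟩
  refine isOneGenerated_of_isBase e
    (isBase_of_triangular (e := e) e (by simp) (by simp) (by simp) (by simp) (by simp) (by simp)
      (by simp) (by simp) (by simp) (by simp)) fun i => ?_
  have m0 := NonUnitalAlgebra.self_mem_adjoin_singleton (ZMod p) (e 0)
  have m1 := mul_mem m0 m0
  rw [h0] at m1
  have m2 : e 2 ∈ NonUnitalAlgebra.adjoin (ZMod p) {e 0} := by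
    rcases hst with ⟨rfl, rfl⟩ | ⟨rfl, rfl⟩
    · simpa [h1] using mul_mem m0 m1
    · simpa [h2] using mul_mem m1 m0
  have m3 : e 3 ∈ NonUnitalAlgebra.adjoin (ZMod p) {e 0} := by
    rcases hgh with rfl | rfl
    · simpa [h3] using mul_mem m0 m2
    · simpa [h4] using mul_mem m2 m0
  fin_cases i <;> assumption

theorem exists_isSecondType_left {α β : ZMod p} (δ μ : ZMod p) (hβ : β ≠ 0) :
    (∃ (P : Type) (_ : LeftPreLieRing P) (_ : LeftPreLieAlgebra (ZMod p) P) (x : P),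
      IsSecondType p x (x * (x * x)) (x * (x * (x * x))) α β δ μ) ∧
    (∃ (P : Type) (_ : LeftPreLieRing P) (_ : LeftPreLieAlgebra (ZMod p) P) (x : P),
      IsSecondType p x (x * (x * x)) ((x * (x * x)) * x) α β δ μ) := by
  constructor
  · obtain ⟨P, i, j, T, e, hm, hc, hl, hgen, h0, h1, h2, h3, h4⟩ :=
      -- Here e₂ = xx², and t, t' come from solving α xx² + β x²x = δ b for x²x; g = 1 makes e₃ =
      -- xa, and h = μ.
      exists_flag_of_length_four 1 0 (-(β⁻¹ * α)) (β⁻¹ * δ) 1 μ (by simp) (by simp)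
    rw [one_smul, zero_smul, add_zero] at h1
    rw [one_smul] at h3
    refine ⟨P, i, j, e 0, isSecondType_of_flag hm hgen (by simp [hc]) hl (Or.inl rfl)
      (Or.inl ⟨rfl, ?_⟩) ?_ ?_ (fun h => hβ h.2) ?_⟩
    all_goals simp [h0, h1, h2, h3, h4, smul_smul, hβ]
  · obtain ⟨P, i, j, T, e, hm, hc, hl, hgen, h0, h1, h2, h3, h4⟩ :=
      exists_flag_of_length_four 1 0 (-(β⁻¹ * α)) (β⁻¹ * δ) μ 1 (by simp) (by simp)
    rw [one_smul, zero_smul, add_zero] at h1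
    rw [one_smul] at h4
    refine ⟨P, i, j, e 0, isSecondType_of_flag hm hgen (by simp [hc]) hl (Or.inl rfl)
      (Or.inr ⟨rfl, ?_⟩) ?_ ?_ (fun h => hβ h.2) ?_⟩
    all_goals simp [h0, h1, h2, h3, h4, smul_smul, hβ]

theorem exists_isSecondType_right {α β : ZMod p} (δ μ : ZMod p) (hα : α ≠ 0) :
    (∃ (P : Type) (_ : LeftPreLieRing P) (_ : LeftPreLieAlgebra (ZMod p) P) (x : P),
      IsSecondType p x ((x * x) * x) (x * ((x * x) * x)) α β δ μ) ∧
    (∃ (P : Type) (_ : LeftPreLieRing P) (_ : LeftPreLieAlgebra (ZMod p) P) (x : P),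
      IsSecondType p x ((x * x) * x) (((x * x) * x) * x) α β δ μ) := by
  constructor
  · obtain ⟨P, i, j, T, e, hm, hc, hl, hgen, h0, h1, h2, h3, h4⟩ :=
      exists_flag_of_length_four (-(α⁻¹ * β)) (α⁻¹ * δ) 1 0 1 μ (by simp) (by simp)
    rw [one_smul, zero_smul, add_zero] at h2
    rw [one_smul] at h3
    refine ⟨P, i, j, e 0, isSecondType_of_flag hm hgen (by simp [hc]) hl (Or.inr rfl)
      (Or.inl ⟨rfl, ?_⟩) ?_ ?_ (fun h => hα h.1) ?_⟩
    all_goals simp [h0, h1, h2, h3, h4, smul_smul, hα]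
  · obtain ⟨P, i, j, T, e, hm, hc, hl, hgen, h0, h1, h2, h3, h4⟩ :=
      exists_flag_of_length_four (-(α⁻¹ * β)) (α⁻¹ * δ) 1 0 μ 1 (by simp) (by simp)
    rw [one_smul, zero_smul, add_zero] at h2
    rw [one_smul] at h4
    refine ⟨P, i, j, e 0, isSecondType_of_flag hm hgen (by simp [hc]) hl (Or.inr rfl)
      (Or.inr ⟨rfl, ?_⟩) ?_ ?_ (fun h => hα h.1) ?_⟩
    all_goals simp [h0, h1, h2, h3, h4, smul_smul, hα]

theorem exists_isThirdType :
    ∃ (P : Type) (_ : LeftPreLieRing P) (_ : LeftPreLieAlgebra (ZMod p) P) (x : P),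
      IsThirdType p x := by
  let T : FlagConstants (ZMod p) := ⟨1, 0, 0, 0, 1, 1, 0, 0, 0, 0, 0⟩
  have hT : T.IsPreLie := ⟨by simp [T], by simp [T]⟩
  let e := FlagAlgebra.basis T hT (Pi.basisFun (ZMod p) (Fin 4))
  have hm : ∀ u v, u * v = flagMul T e u v := FlagAlgebra.mul_eq T hT _
  have h0 : e 0 * e 0 = e 1 := by simp [hm, flagMul, T]
  have h1 : e 0 * e 1 = e 3 := by simp [hm, flagMul, T]
  have h2 : e 1 * e 0 = e 2 := by simp [hm, flagMul, T]
  refine ⟨_, _, inferInstance, e 0, isThirdType_of_flag hm ?_ one_ne_zero rfl rfl rfl⟩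
  refine isOneGenerated_of_isBase e
    (isBase_of_triangular (e := e) e (by simp) (by simp) (by simp) (by simp) (by simp) (by simp)
      (by simp) (by simp) (by simp) (by simp)) fun i => ?_
  have m0 := NonUnitalAlgebra.self_mem_adjoin_singleton (ZMod p) (e 0)
  have m1 := mul_mem m0 m0
  have m2 := mul_mem m1 m0
  have m3 := mul_mem m0 m1
  simp only [h0, h1, h2] at m1 m2 m3
  fin_cases i <;> assumption

end Consistency

/-! ### The entries of a triangular action -/

section FlagAction

variable {p : ℕ} [Fact p.Prime]

theorem ZMod.eq_mul_of_additive {f : ZMod p → ZMod p} (hf : ∀ a b, f (a + b) = f a + f b)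
    (a : ZMod p) : f a = f 1 * a := by
  have := ZMod.map_smul (AddMonoidHom.mk' f hf) a 1
  simpa [mul_comm] using this

/-- The cubic A a²/2 + B a³/3 has the same defect of additivity as f, and the difference is
additive, hence linear. -/
theorem ZMod.eq_cubic (hp : 64 < p) {f : ZMod p → ZMod p} (A B : ZMod p)
    (hf : ∀ a b, f (a + b) = f a + f b + A * (a * b) + B * (a * b ^ 2 + a ^ 2 * b)) :
    ∃ C, ∀ a, f a = A * a ^ 2 / 2 + B * a ^ 3 / 3 + C * a := by
  obtain ⟨h2, h3, -⟩ := flow_ne_zero hp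
  refine ⟨f 1 - (A * 1 ^ 2 / 2 + B * 1 ^ 3 / 3), fun a => ?_⟩
  have := ZMod.eq_mul_of_additive (f := fun a => f a - (A * a ^ 2 / 2 + B * a ^ 3 / 3))
    (fun a b => by
      simp only [hf]
      field_simp
      ring) a
  exact (sub_eq_iff_eq_add'.1 this)

/-- The composition laws of the entries `fᵢⱼ` of a lower unitriangular action `λ` of the group
`a ∘ b = a + λₐ(b)` on a space with coordinates `a₁, a₂, a₃, a₄`, when `λₐ` depends in each row
only on the earlier coordinates. -/
structure FlagAction {K : Type*} [CommRing K] (f21 : K → K) (f31 f32 : K → K → K)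
    (f41 f42 f43 : K → K → K → K) : Prop where
  h21 : ∀ a b, f21 (a + b) = f21 a + f21 b
  h32 : ∀ a a' b b', f32 (a + b) (a' + b' + f21 a * b) = f32 a a' + f32 b b'
  h31 : ∀ a a' b b', f31 (a + b) (a' + b' + f21 a * b) = f31 a a' + f31 b b' + f32 a a' * f21 b
  h43 : ∀ a a' a'' b b' b'', f43 (a + b) (a' + b' + f21 a * b)
    (a'' + b'' + f32 a a' * b' + f31 a a' * b) = f43 a a' a'' + f43 b b' b''
  h42 : ∀ a a' a'' b b' b'', f42 (a + b) (a' + b' + f21 a * b)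
    (a'' + b'' + f32 a a' * b' + f31 a a' * b) =
      f42 a a' a'' + f42 b b' b'' + f43 a a' a'' * f32 b b'
  h41 : ∀ a a' a'' b b' b'', f41 (a + b) (a' + b' + f21 a * b)
    (a'' + b'' + f32 a a' * b' + f31 a a' * b) =
      f41 a a' a'' + f41 b b' b'' + f43 a a' a'' * f31 b b' + f42 a a' a'' * f21 b

/-- Every pair factors as (0, a' - c a²/2) ∘ (a, c a²/2). Each factor runs through a one-parameter
subgroup, on which the composition laws leave one free constant, t or q. -/
theorem FlagAction.exists_level_three (hp : 64 < p) {f21 : ZMod p → ZMod p}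
    {f31 f32 : ZMod p → ZMod p → ZMod p} {f41 f42 f43 : ZMod p → ZMod p → ZMod p → ZMod p}
    (h : FlagAction f21 f31 f32 f41 f42 f43) (hc : f21 1 ≠ 0) :
    ∃ c q s t : ZMod p, c ≠ 0 ∧ (∀ a, f21 a = c * a) ∧ (∀ a a', f32 a a' = s * a) ∧
      ∀ a a', f31 a a' = q * a + t * (a' - c * a ^ 2 / 2) + s * c * a ^ 2 / 2 := by
  obtain ⟨h2, h3, -⟩ := flow_ne_zero hp
  set c := f21 1 with hcdef
  have e21 : ∀ a, f21 a = c * a := ZMod.eq_mul_of_additive h.h21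
  -- In two coordinates ∘ is commutative, so `f31` may be evaluated on the product of (a, a') and
  -- (1, 0) in both orders; c ≠ 0 can then be cancelled.
  have e32 : ∀ a a', f32 a a' = f32 1 0 * a := fun a a' => by
    have e1 := h.h31 a a' 1 0
    have e2 := h.h31 1 0 a a'
    rw [e21, mul_right_comm, mul_one, add_comm a 1, add_comm a' 0] at e1
    rw [e21, mul_one] at e2
    rw [e1, e21, e21] at e2
    exact mul_left_cancel₀ hc (by linear_combination e2)
  set s := f32 1 0
  have et : ∀ a', f31 0 a' = f31 0 1 * a' := ZMod.eq_mul_of_additive fun a b => by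
    have := h.h31 0 a 0 b
    rw [e21, e32] at this
    simpa using this
  set t := f31 0 1
  obtain ⟨q, hq⟩ := ZMod.eq_cubic hp (f := fun a => f31 a (c * a ^ 2 / 2)) (s * c) 0
    (fun a b => by
      have := h.h31 a (c * a ^ 2 / 2) b (c * b ^ 2 / 2)
      rw [e21, e21, e32] at this
      rw [show c * (a + b) ^ 2 / 2 = c * a ^ 2 / 2 + c * b ^ 2 / 2 + c * a * b by
        field_simp; ring, this]
      ring)
  refine ⟨c, q, s, t, hc, e21, e32, fun a a' => ?_⟩
  have := h.h31 0 (a' - c * a ^ 2 / 2) a (c * a ^ 2 / 2)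
  rw [e21, e32, et, hq] at this
  rw [show a' = a' - c * a ^ 2 / 2 + c * a ^ 2 / 2 + c * 0 * a by ring]
  nth_rw 1 [show a = 0 + a by ring]
  rw [this]
  ring

/-- The entries are computed on three one-parameter subgroups x(u), y(v), z(w) belonging to the
first three basis vectors, and every triple is a product z(w) ∘ y(v) ∘ x(u). Products taken in two
orders give the relations between the constants. The points are written as W(u), which turns the
entries into those of e^{L_u}. -/
theorem FlagAction.exists_constants (hp : 64 < p) {f21 : ZMod p → ZMod p}
    {f31 f32 : ZMod p → ZMod p → ZMod p} {f41 f42 f43 : ZMod p → ZMod p → ZMod p → ZMod p}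
    (h : FlagAction f21 f31 f32 f41 f42 f43) (hc : f21 1 ≠ 0)
    (hgen : ¬∃ q, ∀ a a', f32 a a' = 0 ∧ f31 a a' = q * a) :
    ∃ T : FlagConstants (ZMod p), T.IsPreLie ∧ T.c ≠ 0 ∧ ¬(T.s = 0 ∧ T.t = 0) ∧
      (∀ a, f21 a = T.c * a) ∧ (∀ a a', f32 a a' = T.s * a) ∧
      (∀ u v, f31 u (v + T.c * u ^ 2 / 2) = T.q * u + T.t * v + T.s * T.c * u ^ 2 / 2) ∧
      ∀ u v w w', w' = w + (T.q * u ^ 2 + T.s * (u * v) + T.t * (u * v)) / 2 +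
          T.s * T.c * u ^ 3 / 6 →
        f43 u (v + T.c * u ^ 2 / 2) w' = T.g * u + T.l * v ∧
        f42 u (v + T.c * u ^ 2 / 2) w' = T.s' * u + T.k * v + (T.g * u + T.l * v) * (T.s * u) / 2 ∧
        f41 u (v + T.c * u ^ 2 / 2) w' = T.r * u + T.t' * v + T.h * w +
          ((T.s' * u + T.k * v) * (T.c * u) + (T.g * u + T.l * v) * (T.q * u + T.t * v)) / 2 +
          (T.g * u + T.l * v) * (T.s * u) * (T.c * u) / 6 := by
  obtain ⟨h2, h3, h6, -⟩ := flow_ne_zero hp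
  obtain ⟨c, q, s, t, hc, e21, e32, e31⟩ := h.exists_level_three hp hc
  have hst : ¬(s = 0 ∧ t = 0) := by
    rintro ⟨rfl, rfl⟩
    exact hgen ⟨q, fun a a' => ⟨by simp [e32], by simp [e31]⟩⟩
  have H43 : ∀ a a' a'' b b' b'' X Y Z, X = a + b → Y = a' + b' + c * a * b →
      Z = a'' + b'' + s * a * b' + (q * a + t * (a' - c * a ^ 2 / 2) + s * c * a ^ 2 / 2) * b →
      f43 X Y Z = f43 a a' a'' + f43 b b' b'' := by
    rintro a a' a'' b b' b'' _ _ _ rfl rfl rfl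
    rw [← h.h43, e21, e32, e31]
  have H42 : ∀ a a' a'' b b' b'' X Y Z, X = a + b → Y = a' + b' + c * a * b →
      Z = a'' + b'' + s * a * b' + (q * a + t * (a' - c * a ^ 2 / 2) + s * c * a ^ 2 / 2) * b →
      f42 X Y Z = f42 a a' a'' + f42 b b' b'' + f43 a a' a'' * (s * b) := by
    rintro a a' a'' b b' b'' _ _ _ rfl rfl rfl
    rw [← e32 b b', ← h.h42, e21, e32, e31]
  have H41 : ∀ a a' a'' b b' b'' X Y Z, X = a + b → Y = a' + b' + c * a * b →
      Z = a'' + b'' + s * a * b' + (q * a + t * (a' - c * a ^ 2 / 2) + s * c * a ^ 2 / 2) * b →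
      f41 X Y Z = f41 a a' a'' + f41 b b' b'' +
        f43 a a' a'' * (q * b + t * (b' - c * b ^ 2 / 2) + s * c * b ^ 2 / 2) +
        f42 a a' a'' * (c * b) := by
    rintro a a' a'' b b' b'' _ _ _ rfl rfl rfl
    rw [← e31 b b', ← e21 b, ← h.h41, e21, e32, e31]
  clear h hgen
  -- the line of the third basis vector
  have z43 := ZMod.eq_mul_of_additive (f := fun z => f43 0 0 z) fun a b =>
    H43 0 0 a 0 0 b _ _ _ (by ring) (by ring) (by ring)
  have z42 := ZMod.eq_mul_of_additive (f := fun z => f42 0 0 z) fun a b =>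
    (H42 0 0 a 0 0 b _ _ _ (by ring) (by ring) (by ring)).trans (by ring)
  have z41 := ZMod.eq_mul_of_additive (f := fun z => f41 0 0 z) fun a b =>
    (H41 0 0 a 0 0 b _ _ _ (by ring) (by ring) (by ring)).trans (by ring)
  set n := f43 0 0 1
  set m := f42 0 0 1
  set k3 := f41 0 0 1
  -- the line of the second basis vector
  have y43 := ZMod.eq_mul_of_additive (f := fun z => f43 0 z 0) fun a b =>
    H43 0 a 0 0 b 0 _ _ _ (by ring) (by ring) (by ring)
  have y42 := ZMod.eq_mul_of_additive (f := fun z => f42 0 z 0) fun a b =>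
    (H42 0 a 0 0 b 0 _ _ _ (by ring) (by ring) (by ring)).trans (by ring)
  set l := f43 0 1 0
  set k := f42 0 1 0
  obtain ⟨t', y41⟩ := ZMod.eq_cubic hp (f := fun z => f41 0 z 0) (l * t) 0 fun a b => by
    rw [H41 0 a 0 0 b 0 _ _ _ (by ring) (by ring) (by ring), y43]
    ring
  -- the one-parameter subgroup of the first basis vector
  have x43 := ZMod.eq_mul_of_additive
    (f := fun a => f43 a (c * a ^ 2 / 2) (q * a ^ 2 / 2 + s * c * a ^ 3 / 6)) fun a b =>
    H43 a (c * a ^ 2 / 2) (q * a ^ 2 / 2 + s * c * a ^ 3 / 6) b (c * b ^ 2 / 2)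
      (q * b ^ 2 / 2 + s * c * b ^ 3 / 6) _ _ _ (by ring) (by field_simp; ring)
      (by field_simp; ring)
  set g := f43 1 (c * 1 ^ 2 / 2) (q * 1 ^ 2 / 2 + s * c * 1 ^ 3 / 6)
  obtain ⟨s', x42⟩ := ZMod.eq_cubic hp
    (f := fun a => f42 a (c * a ^ 2 / 2) (q * a ^ 2 / 2 + s * c * a ^ 3 / 6)) (g * s) 0
    fun a b => by
    rw [H42 a (c * a ^ 2 / 2) (q * a ^ 2 / 2 + s * c * a ^ 3 / 6) b (c * b ^ 2 / 2)
      (q * b ^ 2 / 2 + s * c * b ^ 3 / 6) _ _ _ (by ring) (by field_simp; ring)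
      (by field_simp; ring), x43]
    ring
  obtain ⟨r, x41⟩ := ZMod.eq_cubic hp
    (f := fun a => f41 a (c * a ^ 2 / 2) (q * a ^ 2 / 2 + s * c * a ^ 3 / 6)) (g * q + s' * c)
    (g * s * c / 2) fun a b => by
    rw [H41 a (c * a ^ 2 / 2) (q * a ^ 2 / 2 + s * c * a ^ 3 / 6) b (c * b ^ 2 / 2)
      (q * b ^ 2 / 2 + s * c * b ^ 3 / 6) _ _ _ (by ring) (by field_simp; ring)
      (by field_simp; ring), x43, x42]
    field_simp
    ring
  -- commutation relations
  have hns : n * s = 0 := by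
    have e1 := H42 0 0 1 1 (c * 1 ^ 2 / 2) (q * 1 ^ 2 / 2 + s * c * 1 ^ 3 / 6)
      1 (c * 1 ^ 2 / 2) (1 + (q * 1 ^ 2 / 2 + s * c * 1 ^ 3 / 6)) (by ring) (by ring) (by ring)
    have e2 := H42 1 (c * 1 ^ 2 / 2) (q * 1 ^ 2 / 2 + s * c * 1 ^ 3 / 6) 0 0 1
      1 (c * 1 ^ 2 / 2) (1 + (q * 1 ^ 2 / 2 + s * c * 1 ^ 3 / 6)) (by ring) (by ring) (by ring)
    rw [e1, z43] at e2
    linear_combination e2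
  have hnm : n * q + m * c = 0 := by
    have e1 := H41 0 0 1 1 (c * 1 ^ 2 / 2) (q * 1 ^ 2 / 2 + s * c * 1 ^ 3 / 6)
      1 (c * 1 ^ 2 / 2) (1 + (q * 1 ^ 2 / 2 + s * c * 1 ^ 3 / 6)) (by ring) (by ring) (by ring)
    have e2 := H41 1 (c * 1 ^ 2 / 2) (q * 1 ^ 2 / 2 + s * c * 1 ^ 3 / 6) 0 0 1
      1 (c * 1 ^ 2 / 2) (1 + (q * 1 ^ 2 / 2 + s * c * 1 ^ 3 / 6)) (by ring) (by ring) (by ring)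
    rw [e1, z43, z42] at e2
    linear_combination e2 - c / 2 * hns
  have hnt : n * t = 0 := by
    have e1 := H41 0 0 1 0 1 0 0 1 1 (by ring) (by ring) (by ring)
    have e2 := H41 0 1 0 0 0 1 0 1 1 (by ring) (by ring) (by ring)
    rw [e1, z43] at e2
    linear_combination e2
  -- Here n and m would be the constants of e₂e₂ and e₂e₁. They vanish because z(1) commutes with
  -- x(1) and y(1), while (s, t) ≠ (0, 0) and c ≠ 0.
  have hn : n = 0 := by
    by_contra hn
    exact hst ⟨by simpa [hn] using hns, by simpa [hn] using hnt⟩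
  have hm : m = 0 := by simpa [hn, hc] using hnm
  simp only [hn, hm, zero_mul] at z43 z42
  -- products of the three families
  have yx43 : ∀ u v, f43 u (v + c * u ^ 2 / 2)
      (q * u ^ 2 / 2 + s * c * u ^ 3 / 6 + t * v * u) = l * v + g * u := fun u v => by
    rw [H43 0 v 0 u (c * u ^ 2 / 2) (q * u ^ 2 / 2 + s * c * u ^ 3 / 6) _ _ _ (by ring) (by ring)
      (by ring), y43, x43]
  have yx42 : ∀ u v, f42 u (v + c * u ^ 2 / 2)
      (q * u ^ 2 / 2 + s * c * u ^ 3 / 6 + t * v * u) =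
        k * v + (g * s * u ^ 2 / 2 + s' * u) + l * v * (s * u) := fun u v => by
    rw [H42 0 v 0 u (c * u ^ 2 / 2) (q * u ^ 2 / 2 + s * c * u ^ 3 / 6) _ _ _ (by ring) (by ring)
      (by ring), y42, x42, y43]
    ring
  have yx41 : ∀ u v, f41 u (v + c * u ^ 2 / 2)
      (q * u ^ 2 / 2 + s * c * u ^ 3 / 6 + t * v * u) =
        (l * t * v ^ 2 / 2 + t' * v) + ((g * q + s' * c) * u ^ 2 / 2 +
          (g * s * c / 2) * u ^ 3 / 3 + r * u) + l * v * (q * u + s * c * u ^ 2 / 2) +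
          k * v * (c * u) := fun u v => by
    rw [H41 0 v 0 u (c * u ^ 2 / 2) (q * u ^ 2 / 2 + s * c * u ^ 3 / 6) _ _ _ (by ring) (by ring)
      (by ring), y41, x41, y43, y42]
    ring
  have z : ∀ u v w, f43 u v w = f43 u v 0 ∧ f42 u v w = f42 u v 0 ∧
      f41 u v w = f41 u v 0 + k3 * w := fun u v w => by
    refine ⟨?_, ?_, ?_⟩
    · rw [H43 0 0 w u v 0 _ _ _ (by ring) (by ring) (by ring), z43]
      ring
    · rw [H42 0 0 w u v 0 _ _ _ (by ring) (by ring) (by ring), z42, z43]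
      ring
    · rw [H41 0 0 w u v 0 _ _ _ (by ring) (by ring) (by ring), z41, z42, z43]
      ring
  -- The products x(1) ∘ y(1) and y(1) ∘ x(1) differ only in the third coordinate, by s against t.
  -- `f42` does not see this coordinate and `f41` sees it through `k3` alone; the comparison gives
  -- this pre-Lie equation and the next one.
  have hsl : s * l = 0 := by
    have e1 := H42 1 (c * 1 ^ 2 / 2) (q * 1 ^ 2 / 2 + s * c * 1 ^ 3 / 6) 0 1 0
      1 (1 + c * 1 ^ 2 / 2) (q * 1 ^ 2 / 2 + s * c * 1 ^ 3 / 6 + s) (by ring) (by ring) (by ring)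
    have e2 := yx42 1 1
    rw [(z _ _ _).2.1] at e1 e2
    rw [e1, x42, y42] at e2
    linear_combination -e2
  have hck : c * k + q * l = t * k3 + t * g - s * k3 := by
    have e1 := H41 1 (c * 1 ^ 2 / 2) (q * 1 ^ 2 / 2 + s * c * 1 ^ 3 / 6) 0 1 0
      1 (1 + c * 1 ^ 2 / 2) (q * 1 ^ 2 / 2 + s * c * 1 ^ 3 / 6 + s) (by ring) (by ring) (by ring)
    have e2 := yx41 1 1
    rw [(z _ _ _).2.2] at e1 e2
    rw [x41, y41, x43] at e1
    linear_combination e1 - e2 - c / 2 * hsl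
  refine ⟨⟨c, q, r, s, s', t, t', g, k3, k, l⟩, ⟨hsl, hck⟩, hc, hst, e21, e32, fun u v => ?_,
    fun u v w w' hw' => ⟨?_, ?_, ?_⟩⟩
  · rw [e31]
    ring
  · rw [(z _ _ _).1, ← (z _ _ _).1, yx43]
    ring
  · rw [(z _ _ _).2.1, ← (z _ _ _).2.1, yx42]
    linear_combination (norm := skip) (u * v / 2) * hsl
    field_simp
    ring
  · have e1 := (z u (v + c * u ^ 2 / 2) w').2.2
    have e2 := (z u (v + c * u ^ 2 / 2) (q * u ^ 2 / 2 + s * c * u ^ 3 / 6 + t * v * u)).2.2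
    rw [yx41] at e2
    dsimp only at hw' ⊢
    linear_combination (norm := skip) e1 - e2 + k3 * hw' + (u * v / 2) * hck +
      (u ^ 2 * v * c / 3) * hsl
    field_simp
    ring

end FlagAction

/-! ### The linear action of the multiplicative group of an `F`-brace -/

section BraceAction

variable {p : ℕ} [Fact p.Prime] {A : Type u} [AddCommGroup A] [Module (ZMod p) A]
  {circ : A → A → A}

theorem IsFBrace.exists_inverse (h : IsFBrace (ZMod p) circ) (a : A) :
    ∃ a', circ a a' = 0 ∧ circ a' a = 0 := by
  obtain ⟨e, he, hinv⟩ := h.exists_neutral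
  have : e = 0 := by rw [← (h.neutral_zero e).2, (he 0).1]
  subst this
  obtain ⟨b, h1, h2⟩ := hinv a
  exact ⟨b, h2, h1⟩

/-- The linear map `b ↦ a ∘ b - a`. -/
def braceAction (h : IsFBrace (ZMod p) circ) (a : A) : A →ₗ[ZMod p] A where
  toFun b := circ a b - a
  map_add' b c := by
    rw [eq_sub_of_add_eq (h.circ_add a b c)]
    abel
  map_smul' r b := by
    have := h.star_smul r a b
    simp only [braceStar, smul_sub] at this
    rw [RingHom.id_apply, smul_sub, ← sub_left_inj (a := r • b), this]

variable (h : IsFBrace (ZMod p) circ)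

theorem braceAction_apply (a b : A) : braceAction h a b = circ a b - a := rfl

theorem circ_eq_add_braceAction (a b : A) : circ a b = a + braceAction h a b := by
  rw [braceAction_apply, add_sub_cancel]

theorem braceStar_eq_braceAction_sub (a b : A) : braceStar circ a b = braceAction h a b - b := rfl

theorem braceAction_zero (b : A) : braceAction h 0 b = b := by
  rw [braceAction_apply, (h.neutral_zero b).1, sub_zero]

theorem braceAction_circ (a b c : A) :
    braceAction h (circ a b) c = braceAction h a (braceAction h b c) := by
  have e := h.circ_assoc a b c
  rw [circ_eq_add_braceAction h (circ a b) c, circ_eq_add_braceAction h a (circ b c),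
    circ_eq_add_braceAction h b c, map_add, circ_eq_add_braceAction h a b, ← add_assoc] at e
  rw [circ_eq_add_braceAction h a b]
  exact add_left_cancel e

theorem braceAction_braceAction_inverse {a a' : A} (e : circ a a' = 0) (b : A) :
    braceAction h a (braceAction h a' b) = b := by
  rw [← braceAction_circ, e, braceAction_zero]

/-- Write a + v = a ∘ v' with v' = λ_a⁻¹(v) in J; the difference is then λ_a(λ_{v'}(b) - b). -/
theorem braceAction_add_sub_mem {I J : Submodule (ZMod p) A}
    (hI : ∀ v ∈ I, ∀ a, braceAction h a v ∈ I) (hJ : ∀ v ∈ J, ∀ a, braceAction h a v ∈ J)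
    (hJI : ∀ v ∈ J, ∀ b, braceAction h v b - b ∈ I) {v : A} (hv : v ∈ J) (a b : A) :
    braceAction h (a + v) b - braceAction h a b ∈ I := by
  obtain ⟨a', ha, -⟩ := h.exists_inverse a
  have : a + v = circ a (braceAction h a' v) := by
    rw [circ_eq_add_braceAction h, braceAction_braceAction_inverse h ha]
  rw [this, braceAction_circ, ← map_sub]
  exact hI _ (hJI _ (hJ v hv a') b) a

theorem braceRightSeries_succ_le (n : ℕ) :
    braceRightSeries circ (n + 1) ≤ braceRightSeries circ n := by
  induction n with
  | zero => exact le_top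
  | succ n ih =>
    refine AddSubgroup.closure_mono ?_
    rintro _ ⟨a, ha, b, rfl⟩
    exact ⟨a, ih ha, b, rfl⟩

/-- Induction based on λ_c(a * b) = (c ∘ a ∘ c⁻¹) * λ_c(b) and c ∘ a ∘ c⁻¹ = λ_c(a + a * c⁻¹), where
c⁻¹ is the inverse for ∘. The radical chain is decreasing, so a * c⁻¹ stays in the term of a. -/
theorem braceAction_mem_braceRightSeries (n : ℕ) :
    ∀ v ∈ braceRightSeries circ n, ∀ c, braceAction h c v ∈ braceRightSeries circ n := by
  induction n with
  | zero => exact fun _ _ _ => AddSubgroup.mem_top _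
  | succ n ih =>
    intro v hv c
    induction hv using AddSubgroup.closure_induction with
    | zero => rw [map_zero]; exact zero_mem _
    | add u v _ _ hu hv => rw [map_add]; exact add_mem hu hv
    | neg u _ hu => rw [map_neg]; exact neg_mem hu
    | mem v hv =>
      obtain ⟨a, ha, b, rfl⟩ := hv
      obtain ⟨c', hc, hc'⟩ := h.exists_inverse c
      have key : circ (circ c a) c' = braceAction h c (a + braceStar circ a c') := by
        have e0 : braceAction h c c' = -c := by
          rw [braceAction_apply, hc, zero_sub]
        rw [h.circ_assoc, circ_eq_add_braceAction h c, circ_eq_add_braceAction h a,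
          braceStar_eq_braceAction_sub h, map_add, map_add, map_sub, e0]
        abel
      have e : braceAction h c (braceStar circ a b) =
          braceStar circ (circ (circ c a) c') (braceAction h c b) := by
        rw [braceStar_eq_braceAction_sub h, braceStar_eq_braceAction_sub h, map_sub,
          braceAction_circ, braceAction_circ, braceAction_braceAction_inverse h hc']
      rw [e, key]
      refine AddSubgroup.subset_closure ⟨_, ih _ (add_mem ha ?_) c, _, rfl⟩
      exact braceRightSeries_succ_le n (AddSubgroup.subset_closure ⟨a, ha, c', rfl⟩)

/-- The set `A` with the multiplication `∘`. -/
def BraceGroup (_ : IsFBrace (ZMod p) circ) : Type u := A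

noncomputable instance : Group (BraceGroup h) :=
  letI : Mul (BraceGroup h) := ⟨circ⟩
  letI : One (BraceGroup h) := ⟨(0 : A)⟩
  letI : Inv (BraceGroup h) := ⟨fun a => (h.exists_inverse a).choose⟩
  Group.ofLeftAxioms h.circ_assoc (fun a => (h.neutral_zero a).1)
    (fun a => (h.exists_inverse a).choose_spec.2)

/-- The p-group (A, ∘) acts through λ on the nonzero p-group (B + I)/I and fixes 0. The number of
fixed points is divisible by p, so there is a nonzero one. -/
theorem exists_braceAction_sub_mem {n : ℕ} (hcard : Nat.card A = p ^ n)
    {I B : Submodule (ZMod p) A} (hI : ∀ v ∈ I, ∀ a, braceAction h a v ∈ I)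
    (hB : ∀ v ∈ B, ∀ a, braceAction h a v ∈ B) (hBI : ¬B ≤ I) :
    ∃ z ∈ B, z ∉ I ∧ ∀ a, braceAction h a z - z ∈ I := by
  have hfin : Finite A := Nat.finite_of_card_ne_zero (by
    rw [hcard]; exact pow_ne_zero _ (Fact.out : p.Prime).ne_zero)
  have hG : IsPGroup p (BraceGroup h) := IsPGroup.of_card hcard
  let _ : MulAction (BraceGroup h) (B.map I.mkQ) :=
    { smul := fun a q => ⟨I.mapQ I (braceAction h a) (fun v hv => hI v hv a) q, by
        obtain ⟨_, v, hv, rfl⟩ := q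
        exact ⟨braceAction h a v, hB v hv a, rfl⟩⟩
      one_smul := by
        rintro ⟨_, v, hv, rfl⟩
        exact Subtype.ext (congrArg I.mkQ (braceAction_zero h v))
      mul_smul := by
        rintro a b ⟨_, v, hv, rfl⟩
        exact Subtype.ext (congrArg I.mkQ (braceAction_circ h a b v)) }
  have hF : Finite (A ⧸ I) := Finite.of_surjective _ I.mkQ_surjective
  have hF' : Finite (B.map I.mkQ) := Finite.of_injective _ Subtype.val_injective
  have hne : Nontrivial (B.map I.mkQ) := by
    rw [Submodule.nontrivial_iff_ne_bot]
    intro hbot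
    refine hBI fun v hv => ?_
    have : I.mkQ v ∈ B.map I.mkQ := ⟨v, hv, rfl⟩
    rw [hbot, Submodule.mem_bot] at this
    simpa using this
  have hdvd : p ∣ Nat.card (B.map I.mkQ) := by
    rw [Module.natCard_eq_pow_finrank (K := ZMod p), Nat.card_zmod]
    exact dvd_pow_self p (Module.finrank_pos).ne'
  obtain ⟨⟨_, z, hz, rfl⟩, hfix, hz0⟩ :=
    hG.exists_fixed_point_of_prime_dvd_card_of_fixed_point (B.map I.mkQ) hdvd
      (a := 0) (fun a => Subtype.ext (map_zero _))
  refine ⟨z, hz, fun hzI => hz0 ?_, fun a => ?_⟩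
  · exact Subtype.ext ((Submodule.Quotient.mk_eq_zero I).2 hzI).symm
  · exact (Submodule.Quotient.eq I).1 (congrArg Subtype.val (hfix a))

/-- One step of a central series: an element which together with the ideal `I` spans an ideal on
which the brace operation is trivial modulo `I`. -/
theorem exists_ideal_step {n : ℕ} (hcard : Nat.card A = p ^ n) (hnil : IsRightNilpotentBrace circ)
    {I : Submodule (ZMod p) A}
    (hI : ∀ j ∈ I, ∀ a, braceAction h a j - j ∈ I ∧ braceAction h j a - a ∈ I) (htop : I ≠ ⊤) :
    ∃ z, z ∉ I ∧ ∀ j ∈ I ⊔ Submodule.span (ZMod p) {z}, ∀ a,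
      braceAction h a j - j ∈ I ∧ braceAction h j a - a ∈ I := by
  classical
  have hI' : ∀ v ∈ I, ∀ a, braceAction h a v ∈ I := fun v hv a => by
    simpa using add_mem (hI v hv a).1 hv
  have hex : ∃ n, ∀ v ∈ braceRightSeries circ n, v ∈ I := by
    obtain ⟨n, hn⟩ := hnil
    refine ⟨n, fun v hv => ?_⟩
    rw [hn, AddSubgroup.mem_bot] at hv
    exact hv ▸ zero_mem I
  -- The last term B of the radical chain not contained in I satisfies B * A ⊆ I; a point z of B
  -- fixed modulo I is then trivial modulo I on both sides.
  obtain ⟨m, hm, hmin⟩ : ∃ m, (∀ v ∈ braceRightSeries circ (m + 1), v ∈ I) ∧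
      ¬∀ v ∈ braceRightSeries circ m, v ∈ I := by
    have h0 : Nat.find hex ≠ 0 := fun h0 => htop (by
      have := Nat.find_spec hex
      rw [h0] at this
      exact eq_top_iff.2 fun v _ => this v (AddSubgroup.mem_top v))
    obtain ⟨m, hm⟩ := Nat.exists_eq_succ_of_ne_zero h0
    exact ⟨m, by rw [← Nat.succ_eq_add_one, ← hm]; exact Nat.find_spec hex,
      Nat.find_min hex (by omega)⟩
  set B := AddSubgroup.toZModSubmodule p (braceRightSeries circ m) with hBdef
  have hBmem : ∀ v, v ∈ B ↔ v ∈ braceRightSeries circ m := fun v => Iff.rfl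
  have hstar : ∀ v ∈ B, ∀ b, braceAction h v b - b ∈ I := fun v hv b =>
    hm _ (AddSubgroup.subset_closure ⟨v, hv, b, rfl⟩)
  obtain ⟨z, hzB, hzI, hz⟩ := exists_braceAction_sub_mem h hcard hI' (B := B)
    (braceAction_mem_braceRightSeries h m) hmin
  refine ⟨z, hzI, fun j hj a => ?_⟩
  obtain ⟨i, hi, w, hw, rfl⟩ := Submodule.mem_sup.1 hj
  obtain ⟨r, rfl⟩ := Submodule.mem_span_singleton.1 hw
  constructor
  · have := add_mem (hI i hi a).1 (I.smul_mem r (hz a))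
    convert this using 1
    rw [map_add, map_smul, smul_sub]
    abel
  · have := add_mem (braceAction_add_sub_mem h hI' hI' (fun v hv b => (hI v hv b).2) hi (r • z) a)
      (hstar _ (B.smul_mem r hzB) a)
    rwa [sub_add_sub_cancel, add_comm] at this

end BraceAction

/-! ### A basis adapted to the action -/

section AdaptedBasis

variable {p : ℕ} [Fact p.Prime] {A : Type u} [AddCommGroup A] [Module (ZMod p) A]
  {circ : A → A → A} (h : IsFBrace (ZMod p) circ)

theorem flagSubmodule_le_of_basis_mem {K V : Type*} [CommRing K] [AddCommGroup V] [Module K V]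
    {b : Module.Basis (Fin 4) K V} {n : ℕ} {I : Submodule K V}
    (hI : ∀ i : Fin 4, n ≤ i.val → b i ∈ I) : flagSubmodule b n ≤ I := by
  intro v hv
  rw [← b.sum_repr v]
  refine sum_mem fun i _ => ?_
  rcases lt_or_ge i.val n with hi | hi
  · rw [hv i hi, zero_smul]
    exact zero_mem I
  · exact I.smul_mem _ (hI i hi)

theorem basis_mem_flagSubmodule {K V : Type*} [CommRing K] [AddCommGroup V] [Module K V]
    (b : Module.Basis (Fin 4) K V) {n : ℕ} {i : Fin 4} (hi : n ≤ i.val) :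
    b i ∈ flagSubmodule b n := by
  intro j hj
  rw [b.repr_self, Finsupp.single_eq_of_ne]
  rintro rfl
  omega

/-- The condition I * A ⊆ I already makes I a subbrace, so a proper I cannot contain the generator.
-/
theorem notMem_ideal_of_generated {x : A} (hx : BraceGeneratedBy circ x)
    {I : Submodule (ZMod p) A} (hI : ∀ j ∈ I, ∀ a, braceAction h j a - a ∈ I) (htop : I ≠ ⊤) :
    x ∉ I := by
  refine fun hxI => htop (Submodule.toAddSubgroup_injective (hx I.toAddSubgroup hxI ?_ ?_))
  · intro a ha b hb
    have := add_mem ha (add_mem (hI a ha b) hb)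
    rwa [sub_add_cancel, ← circ_eq_add_braceAction] at this
  · intro a ha b hab
    have e : braceAction h a b = -a := by rw [braceAction_apply, hab, zero_sub]
    have := hI a ha b
    rw [e] at this
    have := neg_mem (add_mem this ha)
    rwa [show -(-a - b + a) = b by abel] at this

theorem exists_adapted_basis (hcard : Nat.card A = p ^ 4) (hnil : IsRightNilpotentBrace circ)
    {x : A} (hx : BraceGeneratedBy circ x) :
    ∃ e : Module.Basis (Fin 4) (ZMod p) A, e 0 = x ∧ ∀ n < 4, ∀ j ∈ flagSubmodule e n, ∀ a,
      braceAction h a j - j ∈ flagSubmodule e (n + 1) ∧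
        braceAction h j a - a ∈ flagSubmodule e (n + 1) := by
  have hfin : Finite A := Nat.finite_of_card_ne_zero (by
    rw [hcard]; exact pow_ne_zero _ (Fact.out : p.Prime).ne_zero)
  have hrank : Module.finrank (ZMod p) A = 4 := by
    have := Module.natCard_eq_pow_finrank (K := ZMod p) (V := A)
    rw [hcard, Nat.card_zmod] at this
    exact (Nat.pow_right_injective (Fact.out : p.Prime).two_le this).symm
  have hlt : ∀ {I : Submodule (ZMod p) A} {k : ℕ}, Module.finrank (ZMod p) I = k → k < 4 →
      I ≠ ⊤ := by
    rintro I k hk hk4 rfl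
    rw [finrank_top] at hk
    omega
  have hstep : ∀ {I : Submodule (ZMod p) A} {k : ℕ} {z : A}, Module.finrank (ZMod p) I = k →
      z ∉ I → Module.finrank (ZMod p) (I ⊔ Submodule.span (ZMod p) {z} : Submodule _ A) = k + 1 :=
    fun hk hz => by rw [Submodule.finrank_sup_span_singleton hz, hk]
  have f0 : Module.finrank (ZMod p) (⊥ : Submodule (ZMod p) A) = 0 := finrank_bot _ _
  obtain ⟨z1, hz1, H0⟩ := exists_ideal_step h hcard hnil (I := ⊥) (by
    intro j hj a
    rw [Submodule.mem_bot] at hj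
    subst hj
    simp [braceAction_zero]) (hlt f0 (by omega))
  have f1 := hstep f0 hz1
  set I1 : Submodule (ZMod p) A := ⊥ ⊔ Submodule.span (ZMod p) {z1}
  have l1 : (⊥ : Submodule (ZMod p) A) ≤ I1 := le_sup_left
  have m1 : z1 ∈ I1 := Submodule.mem_sup_right (Submodule.mem_span_singleton_self z1)
  obtain ⟨z2, hz2, H1⟩ := exists_ideal_step h hcard hnil
    (fun j hj a => ⟨l1 (H0 j hj a).1, l1 (H0 j hj a).2⟩) (hlt f1 (by omega))
  have f2 := hstep f1 hz2
  set I2 : Submodule (ZMod p) A := I1 ⊔ Submodule.span (ZMod p) {z2}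
  have l2 : I1 ≤ I2 := le_sup_left
  have m2 : z2 ∈ I2 := Submodule.mem_sup_right (Submodule.mem_span_singleton_self z2)
  obtain ⟨z3, hz3, H2⟩ := exists_ideal_step h hcard hnil
    (fun j hj a => ⟨l2 (H1 j hj a).1, l2 (H1 j hj a).2⟩) (hlt f2 (by omega))
  have f3 := hstep f2 hz3
  set I3 : Submodule (ZMod p) A := I2 ⊔ Submodule.span (ZMod p) {z3}
  have l3 : I2 ≤ I3 := le_sup_left
  have m3 : z3 ∈ I3 := Submodule.mem_sup_right (Submodule.mem_span_singleton_self z3)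
  obtain ⟨z4, hz4, H3⟩ := exists_ideal_step h hcard hnil
    (fun j hj a => ⟨l3 (H2 j hj a).1, l3 (H2 j hj a).2⟩) (hlt f3 (by omega))
  have H3' : ∀ j a, braceAction h a j - j ∈ I3 ∧ braceAction h j a - a ∈ I3 := by
    have : I3 ⊔ Submodule.span (ZMod p) {z4} = ⊤ :=
      Submodule.eq_top_of_finrank_eq (by rw [hstep f3 hz4, hrank])
    exact fun j a => H3 j (this ▸ Submodule.mem_top) a
  -- All of A * A lies in the hyperplane `I3`, so x can replace `z4` as the first vector of the
  -- adapted basis.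
  have hxI : x ∉ I3 := notMem_ideal_of_generated h hx (fun j _ a => (H3' j a).2)
    (hlt f3 (by omega))
  have hli : LinearIndependent (ZMod p) ![x, z3, z2, z1] := by
    have hs : ∀ {I : Submodule (ZMod p) A} {n : ℕ} {v : Fin n → A}, (∀ i, v i ∈ I) →
        Submodule.span (ZMod p) (Set.range v) ≤ I := fun hv =>
      Submodule.span_le.2 (Set.range_subset_iff.2 hv)
    refine linearIndependent_finCons.2 ⟨linearIndependent_finCons.2
      ⟨linearIndependent_finCons.2 ⟨linearIndependent_finCons.2
        ⟨linearIndependent_empty_type, fun hm => hz1 (hs (fun i => i.elim0) hm)⟩,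
        fun hm => hz2 (hs ?_ hm)⟩, fun hm => hz3 (hs ?_ hm)⟩, fun hm => hxI (hs ?_ hm)⟩
    · intro i; fin_cases i; exact m1
    · intro i; fin_cases i
      exacts [m2, l2 m1]
    · intro i; fin_cases i
      exacts [m3, l3 m2, l3 (l2 m1)]
  let e : Module.Basis (Fin 4) (ZMod p) A :=
    basisOfLinearIndependentOfCardEqFinrank hli (by simp [hrank])
  have he : ⇑e = ![x, z3, z2, z1] := coe_basisOfLinearIndependentOfCardEqFinrank _ _
  have e0 : e 0 = x := by rw [he]; rfl
  have e1 : e 1 = z3 := by rw [he]; rfl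
  have e2 : e 2 = z2 := by rw [he]; rfl
  have e3 : e 3 = z1 := by rw [he]; rfl
  have F3 : flagSubmodule e 3 ≤ I1 := flagSubmodule_le_of_basis_mem fun i hi => by
    obtain rfl : i = 3 := by omega
    exact e3 ▸ m1
  have F2 : flagSubmodule e 2 ≤ I2 := flagSubmodule_le_of_basis_mem fun i hi => by
    obtain rfl | rfl : i = 3 ∨ i = 2 := by omega
    exacts [e3 ▸ l2 m1, e2 ▸ m2]
  have s : ∀ {I : Submodule (ZMod p) A} {n : ℕ} {i : Fin 4} {z : A}, e i = z → n ≤ i.val →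
      I ≤ flagSubmodule e n → I ⊔ Submodule.span (ZMod p) {z} ≤ flagSubmodule e n := by
    rintro I n i z rfl hi hI
    exact sup_le hI ((Submodule.span_singleton_le_iff_mem _ _).2 (basis_mem_flagSubmodule e hi))
  have mono : ∀ {n : ℕ}, flagSubmodule e (n + 1) ≤ flagSubmodule e n := by
    intro n v hv i hi
    exact hv i (by omega)
  have G3 : I1 ≤ flagSubmodule e 3 := s e3 le_rfl bot_le
  have G2 : I2 ≤ flagSubmodule e 2 := s e2 le_rfl (G3.trans mono)
  have G1 : I3 ≤ flagSubmodule e 1 := s e1 le_rfl (G2.trans mono)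
  refine ⟨e, e0, fun n hn j hj a => ?_⟩
  interval_cases n
  · exact ⟨G1 (H3' j a).1, G1 (H3' j a).2⟩
  · have hj : j ∈ I3 := (flagSubmodule_le_of_basis_mem fun i hi => by
      obtain rfl | rfl | rfl : i = 3 ∨ i = 2 ∨ i = 1 := by omega
      exacts [e3 ▸ l3 (l2 m1), e2 ▸ l3 m2, e1 ▸ m3] : flagSubmodule e 1 ≤ I3) hj
    exact ⟨G2 (H2 j hj a).1, G2 (H2 j hj a).2⟩
  · exact ⟨G3 (H1 j (F2 hj) a).1, G3 (H1 j (F2 hj) a).2⟩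
  · exact ⟨bot_le (a := flagSubmodule e 4) (H0 j (F3 hj) a).1,
      bot_le (a := flagSubmodule e 4) (H0 j (F3 hj) a).2⟩

end AdaptedBasis

/-! ### The brace in coordinates -/

section Coordinates

variable {p : ℕ} [Fact p.Prime] {A : Type u} [AddCommGroup A] [Module (ZMod p) A]
  {circ : A → A → A} (h : IsFBrace (ZMod p) circ) {e : Module.Basis (Fin 4) (ZMod p) A}

theorem braceAction_mem_flagSubmodule
    (he : ∀ n < 4, ∀ j ∈ flagSubmodule e n, ∀ a, braceAction h a j - j ∈ flagSubmodule e (n + 1) ∧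
      braceAction h j a - a ∈ flagSubmodule e (n + 1)) (n : ℕ) :
    ∀ v ∈ flagSubmodule e n, ∀ a, braceAction h a v ∈ flagSubmodule e n := by
  intro v hv a
  rcases lt_or_ge n 4 with hn | hn
  · have h1 : braceAction h a v - v ∈ flagSubmodule e n := fun i hi =>
      (he n hn v hv a).1 i (by omega)
    simpa using add_mem h1 hv
  · obtain rfl : v = 0 := e.ext_elem fun i => by
      rw [hv i (by omega), map_zero, Finsupp.zero_apply]
    rw [map_zero]
    exact zero_mem _

/-- If a and a' agree before coordinate k, their difference lies in the k-th step J of the flag, and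
J * A lies in the next step, so λ_a and λ_{a'} agree through coordinate k. -/
theorem repr_braceAction_congr
    (he : ∀ n < 4, ∀ j ∈ flagSubmodule e n, ∀ a, braceAction h a j - j ∈ flagSubmodule e (n + 1) ∧
      braceAction h j a - a ∈ flagSubmodule e (n + 1)) {a a' : A} (k : Fin 4)
    (ha : ∀ i : Fin 4, i.val < k.val → e.repr a i = e.repr a' i) (b : A) :
    e.repr (braceAction h a b) k = e.repr (braceAction h a' b) k := by
  have hv : a - a' ∈ flagSubmodule e k.val := fun i hi => by
    rw [map_sub, Finsupp.sub_apply, ha i hi, sub_self]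
  have := braceAction_add_sub_mem h (braceAction_mem_flagSubmodule h he (k.val + 1))
    (braceAction_mem_flagSubmodule h he k.val) (fun v hv b => (he k.val k.isLt v hv b).2) hv a' b
  rw [add_sub_cancel] at this
  have := this k (Nat.lt_succ_self _)
  rwa [map_sub, Finsupp.sub_apply, sub_eq_zero] at this

theorem repr_braceAction_basis
    (he : ∀ n < 4, ∀ j ∈ flagSubmodule e n, ∀ a, braceAction h a j - j ∈ flagSubmodule e (n + 1) ∧
      braceAction h j a - a ∈ flagSubmodule e (n + 1)) (a : A) {i k : Fin 4} (hk : k ≤ i) :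
    e.repr (braceAction h a (e i)) k = if k = i then 1 else 0 := by
  have := (he i.val i.isLt (e i) (basis_mem_flagSubmodule e le_rfl) a).1 k
    (Nat.lt_succ_of_le hk)
  rw [map_sub, Finsupp.sub_apply, sub_eq_zero] at this
  rw [this, e.repr_self, Finsupp.single_apply]
  simp only [eq_comm]

theorem repr_braceAction_sum (a v : A) (k : Fin 4) :
    e.repr (braceAction h a v) k = ∑ i, e.repr v i * e.repr (braceAction h a (e i)) k := by
  conv_lhs => rw [← e.sum_repr v]
  simp only [map_sum, map_smul, Finsupp.finsetSum_apply, Finsupp.smul_apply, smul_eq_mul]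

theorem exists_flagAction
    (he : ∀ n < 4, ∀ j ∈ flagSubmodule e n, ∀ a, braceAction h a j - j ∈ flagSubmodule e (n + 1) ∧
      braceAction h j a - a ∈ flagSubmodule e (n + 1)) :
    ∃ (f21 : ZMod p → ZMod p) (f31 f32 : ZMod p → ZMod p → ZMod p)
      (f41 f42 f43 : ZMod p → ZMod p → ZMod p → ZMod p), FlagAction f21 f31 f32 f41 f42 f43 ∧
      ∀ a v, e.repr (braceAction h a v) 0 = e.repr v 0 ∧
        e.repr (braceAction h a v) 1 = e.repr v 1 + f21 (e.repr a 0) * e.repr v 0 ∧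
        e.repr (braceAction h a v) 2 = e.repr v 2 + f32 (e.repr a 0) (e.repr a 1) * e.repr v 1 +
          f31 (e.repr a 0) (e.repr a 1) * e.repr v 0 ∧
        e.repr (braceAction h a v) 3 = e.repr v 3 +
          f43 (e.repr a 0) (e.repr a 1) (e.repr a 2) * e.repr v 2 +
          f42 (e.repr a 0) (e.repr a 1) (e.repr a 2) * e.repr v 1 +
          f41 (e.repr a 0) (e.repr a 1) (e.repr a 2) * e.repr v 0 := by
  -- Representatives with last coordinate zero suffice, since no row of λ_a depends on the last
  -- coordinate of a.
  set m : ZMod p → ZMod p → ZMod p → A := fun x y z => x • e 0 + y • e 1 + z • e 2 with hm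
  have m0 : ∀ x y z, e.repr (m x y z) 0 = x := by simp [hm]
  have m1 : ∀ x y z, e.repr (m x y z) 1 = y := by simp [hm]
  have m2 : ∀ x y z, e.repr (m x y z) 2 = z := by simp [hm]
  have m3 : ∀ x y z, e.repr (m x y z) 3 = 0 := by simp [hm]
  refine ⟨fun x => e.repr (braceAction h (m x 0 0) (e 0)) 1,
    fun x y => e.repr (braceAction h (m x y 0) (e 0)) 2,
    fun x y => e.repr (braceAction h (m x y 0) (e 1)) 2,
    fun x y z => e.repr (braceAction h (m x y z) (e 0)) 3,
    fun x y z => e.repr (braceAction h (m x y z) (e 1)) 3,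
    fun x y z => e.repr (braceAction h (m x y z) (e 2)) 3, ?_⟩
  set f21 : ZMod p → ZMod p := fun x => e.repr (braceAction h (m x 0 0) (e 0)) 1 with d21
  set f31 : ZMod p → ZMod p → ZMod p := fun x y => e.repr (braceAction h (m x y 0) (e 0)) 2
    with d31
  set f32 : ZMod p → ZMod p → ZMod p := fun x y => e.repr (braceAction h (m x y 0) (e 1)) 2
    with d32
  set f41 : ZMod p → ZMod p → ZMod p → ZMod p :=
    fun x y z => e.repr (braceAction h (m x y z) (e 0)) 3 with d41
  set f42 : ZMod p → ZMod p → ZMod p → ZMod p :=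
    fun x y z => e.repr (braceAction h (m x y z) (e 1)) 3 with d42
  set f43 : ZMod p → ZMod p → ZMod p → ZMod p :=
    fun x y z => e.repr (braceAction h (m x y z) (e 2)) 3 with d43
  have c1 : ∀ a b, e.repr (braceAction h a b) 1 =
      e.repr (braceAction h (m (e.repr a 0) 0 0) b) 1 := fun a b =>
    repr_braceAction_congr h he 1 (fun i hi => by
      obtain rfl : i = 0 := by omega
      rw [m0]) b
  have c2 : ∀ a b, e.repr (braceAction h a b) 2 =
      e.repr (braceAction h (m (e.repr a 0) (e.repr a 1) 0) b) 2 := fun a b =>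
    repr_braceAction_congr h he 2 (fun i hi => by
      obtain rfl | rfl : i = 0 ∨ i = 1 := by omega
      exacts [(m0 _ _ _).symm, (m1 _ _ _).symm]) b
  have c3 : ∀ a b, e.repr (braceAction h a b) 3 =
      e.repr (braceAction h (m (e.repr a 0) (e.repr a 1) (e.repr a 2)) b) 3 := fun a b =>
    repr_braceAction_congr h he 3 (fun i hi => by
      obtain rfl | rfl | rfl : i = 0 ∨ i = 1 ∨ i = 2 := by omega
      exacts [(m0 _ _ _).symm, (m1 _ _ _).symm, (m2 _ _ _).symm]) b
  have F : ∀ a v, e.repr (braceAction h a v) 0 = e.repr v 0 ∧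
        e.repr (braceAction h a v) 1 = e.repr v 1 + f21 (e.repr a 0) * e.repr v 0 ∧
        e.repr (braceAction h a v) 2 = e.repr v 2 + f32 (e.repr a 0) (e.repr a 1) * e.repr v 1 +
          f31 (e.repr a 0) (e.repr a 1) * e.repr v 0 ∧
        e.repr (braceAction h a v) 3 = e.repr v 3 +
          f43 (e.repr a 0) (e.repr a 1) (e.repr a 2) * e.repr v 2 +
          f42 (e.repr a 0) (e.repr a 1) (e.repr a 2) * e.repr v 1 +
          f41 (e.repr a 0) (e.repr a 1) (e.repr a 2) * e.repr v 0 := by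
    intro a v
    have B := fun (i k : Fin 4) (hk : k ≤ i) => repr_braceAction_basis h he a hk
    refine ⟨?_, ?_, ?_, ?_⟩ <;> rw [repr_braceAction_sum, Fin.sum_univ_four]
    · rw [B 0 0 le_rfl, B 1 0 (by decide), B 2 0 (by decide), B 3 0 (by decide)]
      simp
    · rw [c1 a (e 0), B 1 1 le_rfl, B 2 1 (by decide), B 3 1 (by decide)]
      simp [d21]
      ring
    · rw [c2 a (e 0), c2 a (e 1), B 2 2 le_rfl, B 3 2 (by decide)]
      simp [d31, d32]
      ring
    · rw [c3 a (e 0), c3 a (e 1), c3 a (e 2), B 3 3 le_rfl]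
      simp [d41, d42, d43]
      ring
  refine ⟨?_, F⟩
  clear_value f21 f31 f32 f41 f42 f43
  clear c1 c2 c3
  have hcirc : ∀ a b v k, e.repr (braceAction h (a + braceAction h a b) v) k =
      e.repr (braceAction h a (braceAction h b v)) k := fun a b v k => by
    rw [← circ_eq_add_braceAction, braceAction_circ]
  have G0 : ∀ a a' a'' b b' b'', e.repr (m a a' a'' + braceAction h (m a a' a'') (m b b' b'')) 0 =
      a + b := fun a a' a'' b b' b'' => by
    rw [map_add, Finsupp.add_apply, (F _ _).1, m0, m0]
  have G1 : ∀ a a' a'' b b' b'', e.repr (m a a' a'' + braceAction h (m a a' a'') (m b b' b'')) 1 =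
      a' + b' + f21 a * b := fun a a' a'' b b' b'' => by
    rw [map_add, Finsupp.add_apply, (F _ _).2.1, m0, m1, m1, m0, add_assoc]
  have G2 : ∀ a a' a'' b b' b'', e.repr (m a a' a'' + braceAction h (m a a' a'') (m b b' b'')) 2 =
      a'' + b'' + f32 a a' * b' + f31 a a' * b := fun a a' a'' b b' b'' => by
    rw [map_add, Finsupp.add_apply, (F _ _).2.2.1, m0, m1, m2, m2, m1, m0]
    ring
  constructor
  · intro a b
    have := hcirc (m a 0 0) (m b 0 0) (e 0) 1
    simp only [(F _ _).1, (F _ _).2.1, G0, m0] at this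
    simp at this
    rw [this, add_comm]
  · intro a a' b b'
    have := hcirc (m a a' 0) (m b b' 0) (e 1) 2
    simp only [(F _ _).1, (F _ _).2.1, (F _ _).2.2.1, G0, G1, m0, m1] at this
    simp at this
    rw [this, add_comm]
  · intro a a' b b'
    have := hcirc (m a a' 0) (m b b' 0) (e 0) 2
    simp only [(F _ _).1, (F _ _).2.1, (F _ _).2.2.1, G0, G1, m0, m1] at this
    simp at this
    rw [this]
    ring
  · intro a a' a'' b b' b''
    have := hcirc (m a a' a'') (m b b' b'') (e 2) 3
    simp only [(F _ _).1, (F _ _).2.1, (F _ _).2.2.1, (F _ _).2.2.2, G0, G1, G2, m0, m1, m2] at this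
    simp at this
    rw [this]
    ring
  · intro a a' a'' b b' b''
    have := hcirc (m a a' a'') (m b b' b'') (e 1) 3
    simp only [(F _ _).1, (F _ _).2.1, (F _ _).2.2.1, (F _ _).2.2.2, G0, G1, G2, m0, m1, m2] at this
    simp at this
    rw [this]
    ring
  · intro a a' a'' b b' b''
    have := hcirc (m a a' a'') (m b b' b'') (e 0) 3
    simp only [(F _ _).1, (F _ _).2.1, (F _ _).2.2.1, (F _ _).2.2.2, G0, G1, G2, m0, m1, m2] at this
    simp at this
    rw [this]
    ring

/-- A subspace which contains the generator and is given by the vanishing of a linear form that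
is compatible with `∘` is the whole space. -/
theorem eq_zero_of_braceGeneratedBy {x : A} (hx : BraceGeneratedBy circ x)
    (f : A →ₗ[ZMod p] ZMod p) (hfx : f x = 0)
    (hf : ∀ a b, f a = 0 → f (braceAction h a b) = f b) (v : A) : f v = 0 := by
  have htop := hx (LinearMap.ker f).toAddSubgroup hfx ?_ ?_
  · have : v ∈ (LinearMap.ker f).toAddSubgroup := htop ▸ AddSubgroup.mem_top v
    exact this
  · intro a ha b hb
    change f a = 0 at ha
    change f b = 0 at hb
    change f (circ a b) = 0
    rw [circ_eq_add_braceAction h, map_add, hf a b ha, ha, hb, add_zero]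
  · intro a ha b hab
    change f a = 0 at ha
    change f b = 0
    have e : braceAction h a b = -a := by rw [braceAction_apply, hab, zero_sub]
    rw [← hf a b ha, e, map_neg, ha, neg_zero]

end Coordinates

/-! ### ### From braces to listed pre-Lie algebras, and the main theorem -/

section Main

variable {p : ℕ} [Fact p.Prime] {A : Type u} [AddCommGroup A] [Module (ZMod p) A]
  {circ : A → A → A}

theorem exists_listed_preLie (hp : 64 < p) (h : IsFBrace (ZMod p) circ)
    (hcard : Nat.card A = p ^ 4) (hnil : IsRightNilpotentBrace circ) {x : A}
    (hx : BraceGeneratedBy circ x) :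
    ∃ (P : Type u) (_ : LeftPreLieRing P) (_ : LeftPreLieAlgebra (ZMod p) P)
      (φ : A ≃ₗ[ZMod p] P), IsListed p (φ x) ∧
        ∀ a b, φ (circ a b) = flowCirc p (φ a) (φ b) := by
  obtain ⟨e, rfl, he⟩ := exists_adapted_basis h hcard hnil hx
  obtain ⟨f21, f31, f32, f41, f42, f43, hf, F⟩ := exists_flagAction h he
  -- Otherwise λ fixes the coordinate form e₁*, which vanishes at x = e₀ and would have to be zero.
  have hc : f21 1 ≠ 0 := by
    intro h0
    have h1 : ∀ a, f21 a = 0 := fun a => by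
      rw [ZMod.eq_mul_of_additive hf.h21 a, h0, zero_mul]
    have := eq_zero_of_braceGeneratedBy h hx (e.coord 1) (by simp)
      (fun a b _ => by simp [(F a b).2.1, h1]) (e 1)
    simp at this
  -- Otherwise, with c = `f21 1`, the form c e₂* - q e₁* is fixed by λ and vanishes at x, but it
  -- takes the value c ≠ 0 at e₂.
  have hgen : ¬∃ q, ∀ a a', f32 a a' = 0 ∧ f31 a a' = q * a := by
    rintro ⟨q, hq⟩
    have := eq_zero_of_braceGeneratedBy h hx (f21 1 • e.coord 2 - q • e.coord 1) (by simp)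
      (fun a b _ => by
        simp [(F a b).2.1, (F a b).2.2.1, hq, ZMod.eq_mul_of_additive hf.h21 (e.repr a 0)]
        ring) (e 2)
    simp at this
    exact hc this
  obtain ⟨T, hT, hTc, hst, e21, e32, e31, e4⟩ := hf.exists_constants hp hc hgen
  have hmul := FlagAlgebra.mul_eq T hT e
  set φ := FlagAlgebra.equiv T hT e
  have hrepr : ∀ a i, (FlagAlgebra.basis T hT e).repr (φ a) i = e.repr a i := fun a i => by
    simp [FlagAlgebra.basis, φ]
  have h0 : FlagAlgebra.basis T hT e 0 = φ (e 0) := by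
    simp [FlagAlgebra.basis, φ]
  set b := FlagAlgebra.basis T hT e
  have hcirc : ∀ v w, φ (circ v w) = flowCirc p (φ v) (φ w) := by
    intro v w
    -- With φ(v) = W(u), it remains to match λ_v with e^{L_u} row by row; the entries were expressed
    -- at the coordinates of W(u) for this purpose.
    obtain ⟨u, hu⟩ := flowW_surjective hp hmul (φ v)
    obtain ⟨w0, w1, w2⟩ := repr_flowW hp hmul u
    obtain ⟨x0, x1, x2, x3⟩ := repr_flowExp hp hmul u (φ w)
    rw [← hu, flowCirc_flowW hp hmul, hu, circ_eq_add_braceAction h, map_add]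
    congr 1
    rw [hu, hrepr] at w0 w1 w2
    obtain ⟨E43, E42, E41⟩ := e4 _ _ _ _ w2
    rw [← w1, ← w0] at E43 E42 E41
    obtain ⟨y0, y1, y2, y3⟩ := F v w
    have e31' := e31 (b.repr u 0) (b.repr u 1)
    rw [← w1, ← w0] at e31'
    apply b.eq_of_repr_fin_four
    · rw [x0, hrepr, hrepr, y0]
    · rw [x1, hrepr, hrepr, hrepr, y1, e21, w0]
      ring
    · rw [x2, hrepr, hrepr, hrepr, hrepr, y2, e32, e31', w0]
    · rw [x3, hrepr, hrepr, hrepr, hrepr, hrepr, y3, E43, E42, E41, w0]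
  have hgenP : BraceGeneratedBy (flowCirc p) (b 0) := by
    intro S hS h1 h2
    have := hx (S.comap φ.toLinearMap.toAddMonoidHom) (by rw [h0] at hS; exact hS)
      (fun v hv w hw => by
        change φ (circ v w) ∈ S
        rw [hcirc]
        exact h1 _ hv _ hw)
      (fun v hv w hvw => h2 _ hv _ (by
        change flowCirc p (φ v) (φ w) = 0
        rw [← hcirc, hvw, map_zero]))
    refine (AddSubgroup.eq_top_iff' S).2 fun y => ?_
    obtain ⟨v, rfl⟩ := φ.surjective y
    have hv : v ∈ S.comap φ.toLinearMap.toAddMonoidHom := this ▸ AddSubgroup.mem_top v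
    exact hv
  refine ⟨FlagAlgebra T hT e, inferInstance, inferInstance, φ, ?_, hcirc⟩
  rw [← h0]
  exact isListed_of_flag hmul ⟨by rw [← hcard]; exact (Nat.card_congr φ.toEquiv).symm,
    adjoin_eq_top_of_braceGeneratedBy hp hmul hgenP⟩ hTc hst

end Main

theorem mainTheorem5 (p : ℕ) [Fact p.Prime] (hp : 2 ^ 6 < p) :
    -- every one-generator right nilpotent brace is the group of flows of a listed algebra
    (∀ (A : Type u) [AddCommGroup A] [Module (ZMod p) A] (circ : A → A → A) (x : A),
      IsFBrace (ZMod p) circ → Nat.card A = p ^ 4 → IsRightNilpotentBrace circ →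
      BraceGeneratedBy circ x →
      ∃ (P : Type u) (_ : LeftPreLieRing P) (_ : LeftPreLieAlgebra (ZMod p) P)
        (φ : A ≃ₗ[ZMod p] P), IsListed p (φ x) ∧
          ∀ a b, φ (circ a b) = flowCirc p (φ a) (φ b)) ∧
    -- conversely, the group of flows of each listed algebra is such a brace
    (∀ (P : Type u) [LeftPreLieRing P] [LeftPreLieAlgebra (ZMod p) P] (x : P),
      IsListed p x →
      IsFBrace (ZMod p) (flowCirc p : P → P → P) ∧ Nat.card P = p ^ 4 ∧
        IsRightNilpotentBrace (flowCirc p : P → P → P) ∧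
        BraceGeneratedBy (flowCirc p : P → P → P) x) ∧
    -- the relations of the list are consistent for all values of the parameters
    (∀ α β γ : ZMod p, ∃ (P : Type) (_ : LeftPreLieRing P) (_ : LeftPreLieAlgebra (ZMod p) P)
      (x : P), IsFirstType p x α β γ) ∧
    (∀ α β δ μ : ZMod p, β ≠ 0 →
      (∃ (P : Type) (_ : LeftPreLieRing P) (_ : LeftPreLieAlgebra (ZMod p) P) (x : P),
        IsSecondType p x (x * (x * x)) (x * (x * (x * x))) α β δ μ) ∧
      (∃ (P : Type) (_ : LeftPreLieRing P) (_ : LeftPreLieAlgebra (ZMod p) P) (x : P),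
        IsSecondType p x (x * (x * x)) ((x * (x * x)) * x) α β δ μ)) ∧
    (∀ α β δ μ : ZMod p, α ≠ 0 →
      (∃ (P : Type) (_ : LeftPreLieRing P) (_ : LeftPreLieAlgebra (ZMod p) P) (x : P),
        IsSecondType p x ((x * x) * x) (x * ((x * x) * x)) α β δ μ) ∧
      (∃ (P : Type) (_ : LeftPreLieRing P) (_ : LeftPreLieAlgebra (ZMod p) P) (x : P),
        IsSecondType p x ((x * x) * x) (((x * x) * x) * x) α β δ μ)) ∧
    (∃ (P : Type) (_ : LeftPreLieRing P) (_ : LeftPreLieAlgebra (ZMod p) P) (x : P),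
      IsThirdType p x) := by
  replace hp : 64 < p := by simpa using hp
  refine ⟨fun A _ _ circ x h hcard hnil hx => exists_listed_preLie hp h hcard hnil hx,
    fun P _ _ x hx => ?_, exists_isFirstType, fun _ _ δ μ => exists_isSecondType_left δ μ,
    fun _ _ δ μ => exists_isSecondType_right δ μ, exists_isThirdType⟩
  obtain ⟨⟨hcard, hgen⟩, T, b, hT⟩ := hx.exists_flag
  exact ⟨flag_isFBrace hp hT, hcard, flag_isRightNilpotent hp hT, flag_braceGeneratedBy hp hT hgen⟩
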